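/- **Setting.** Let $n\ge 1$ and let $\mathcal D$ be a probability distribution on $\mathbb R^d\times\mathbb R^K$ such that, almost surely for $(x,y)\sim\mathcal D$, the input has unit Euclidean norm, $\|x\|=1$, and the label is one-hot encoded, $y\in\{e_1,\dots,e_K\}$. Let $S=\{(x_i,y_i)\}_{i=1}^n$ be drawn i.i.d. from $\mathcal D$, and let $X\in\mathbb R^{n\times d}$ be the matrix with rows $x_i$ and $y\in\mathbb R^{nK}$ the concatenated label vector. Consider the one-hidden-layer network $f(x;W)=V\phi(Wx)$ with input weights $W\in\mathbb R^{k\times d}$ and fixed output weights $V\in\mathbb R^{K\times k}$, where $\phi:\mathbb R\to\mathbb R$ acts entrywise, is twice differentiable, and satisfies $|\phi'|,|\phi''|\le B$ for some $B>0$; assume $\max_{\ell,s}|V_{\ell s}|\le \nu/\sqrt{kK}$ for some $\nu>0$. Write $f(W)\in\mathbb R^{nK}$ for the concatenation of $f(x_1;W),\dots,f(x_n;W)$ and $\mathcal J(W)\in\mathbb R^{nK\times kd}$ for the Jacobian of $W\mapsto f(W)$. From an initialization $W_0$, gradient descent with step size $\eta$ is $W_{\tau+1}=W_\tau-\eta\nabla\mathcal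 L(W_\tau)$, $\mathcal L(W)=\frac12\|f(W)-y\|^2$. The classification error is $$\mathrm{Err}(W)=\mathbb P_{(x,y)\sim\mathcal D}\{\arg\max_\ell y_\ell\ne\arg\max_\ell f_\ell(x;W)\},$$ where a tie for the maximum of $f(x;W)$ counts as an error. Let $\bar\alpha>0$ and $\alpha=\nu B\bar\alpha\, n^{1/4}\sqrt{\|X\|}$, with $\|X\|$ the spectral norm. Let $J=\mathcal J(W_0)=\sum_s\lambda_s u_sv_s^T$ be a singular value decomposition, with $(u_s)_{s=1}^{nK}$ an orthonormal basis of $\mathbb R^{nK}$ and $\lambda_1\ge\lambda_2\ge\dots\ge 0$. Let $\mathcal N=\mathrm{span}\{u_s:\lambda_s<\alpha\}$ be the nuisance space, $\Pi_{\mathcal N}$ the orthogonal projection onto it, $J_{\mathcal I}=\sum_{s:\lambda_s\ge\alpha}\lambda_su_sv_s^T$ the truncation of $J$ to the information space, $J_{\mathcal I}^\dagger$ its Moore–Penrose pseudo-inverse, and $r_0=f(W_0)-y$ the initial residual. **Theorem.** There is an absolute constant $c>0$ such that the following holds in the above setting for every deterministic (i.e. not depending on the sample, but otherwise arbitrary,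 e.g. pre-trained) initialization $W_0\in\mathbb R^{k\times d}$ and all fixed $0<\zeta\le\frac12$, $\Gamma\ge1$, $\bar\alpha>0$, $C_r>0$ and $\delta\in(0,1)$. If $$k\ \ge\ c\,\frac{C_r^2\Gamma^4}{\bar\alpha^8\nu^2B^2\zeta^2},$$ then there is an event of probability at least $1-\delta$ over the sample on which the following is true. If $\|r_0\|/\sqrt n\le C_r$ and $\alpha\le\lambda_1$, then for every step size $0<\eta\le\frac{1}{\nu^2B^2\|X\|^2}$ for which $T=\frac{\Gamma}{\eta\alpha^2}$ is an integer, after $T$ gradient descent iterations $$\mathrm{Err}(W_T)\le\frac{2\|\Pi_{\mathcal N}(r_0)\|}{\sqrt n}+\frac{12\nu B}{\sqrt n}\Big(\|J_{\mathcal I}^\dagger r_0\|+\frac{\Gamma}{\alpha}\|\Pi_{\mathcal N}(r_0)\|\Big)+5\sqrt{\frac{\log(2/\delta)}{n}}+2C_r\big(e^{-\Gamma}+\zeta\big).$$ -/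

import Mathlib

open MeasureTheory
open scoped Matrix Matrix.Norms.L2Operator

noncomputable section

namespace NNGen

/-! ### Linear algebra: pseudo-inverse, singular vectors, information and nuisance spaces

Throughout, the norm of a matrix is its spectral norm (scope `Matrix.Norms.L2Operator`). -/

section LinearAlgebra

variable {m p : Type*} [Fintype m] [DecidableEq m] [Fintype p] [DecidableEq p]

/-- The four Penrose equations: `P` is the Moore-Penrose pseudo-inverse of the real matrix `A`. -/
structure IsPseudoInverse (A : Matrix m p ℝ) (P : Matrix p m ℝ) : Prop where
  mul_mul_self : A * P * A = A
  self_mul_mul : P * A * P = P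
  symm_left : (A * P)ᵀ = A * P
  symm_right : (P * A)ᵀ = P * A

theorem exists_isPseudoInverse (A : Matrix m p ℝ) : ∃ P, IsPseudoInverse A P := by
  have hS : (A * Aᵀ).IsHermitian := by
    have h := Matrix.isHermitian_mul_conjTranspose_self A
    rwa [Matrix.conjTranspose_eq_transpose_of_trivial] at h
  obtain ⟨U, D, hU1, hSU⟩ : ∃ (U : Matrix m m ℝ) (D : m → ℝ), Uᵀ * U = 1 ∧
      A * Aᵀ = U * Matrix.diagonal D * Uᵀ := by
    refine ⟨hS.eigenvectorUnitary, hS.eigenvalues, ?_, ?_⟩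
    · have h := Unitary.coe_star_mul_self hS.eigenvectorUnitary
      rwa [Matrix.star_eq_conjTranspose, Matrix.conjTranspose_eq_transpose_of_trivial] at h
    · have h := hS.spectral_theorem
      rw [Unitary.conjStarAlgAut_apply, Matrix.star_eq_conjTranspose,
        Matrix.conjTranspose_eq_transpose_of_trivial] at h
      exact h
  have key : ∀ E F : m → ℝ, (U * Matrix.diagonal E * Uᵀ) * (U * Matrix.diagonal F * Uᵀ)
      = U * Matrix.diagonal (fun i => E i * F i) * Uᵀ := by
    intro E F
    calc (U * Matrix.diagonal E * Uᵀ) * (U * Matrix.diagonal F * Uᵀ)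
        = U * Matrix.diagonal E * (Uᵀ * U) * Matrix.diagonal F * Uᵀ := by
          simp only [Matrix.mul_assoc]
      _ = _ := by
          rw [hU1, Matrix.mul_one, Matrix.mul_assoc U, Matrix.diagonal_mul_diagonal]
  have ktr : ∀ E : m → ℝ, (U * Matrix.diagonal E * Uᵀ)ᵀ = U * Matrix.diagonal E * Uᵀ := by
    intro E
    simp [Matrix.transpose_mul, Matrix.mul_assoc]
  set G := U * Matrix.diagonal (fun i => (D i)⁻¹) * Uᵀ with hG
  set Q := U * Matrix.diagonal (fun i => D i * (D i)⁻¹) * Uᵀ with hQ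
  have hSG : A * Aᵀ * G = Q := by rw [hSU, key]
  have hQS : Q * (A * Aᵀ) = A * Aᵀ := by
    rw [hSU, key]; congr 3; ext i
    by_cases h : D i = 0 <;> simp [h]
  have hGQ : G * Q = G := by
    rw [hG, hQ, key]; congr 3; ext i
    by_cases h : D i = 0 <;> simp [h]
  have hQA : Q * A = A := by
    have h0 : (A - Q * A) * (A - Q * A)ᵀ = 0 := by
      have : (A - Q * A) * (A - Q * A)ᵀ
          = (A * Aᵀ - Q * (A * Aᵀ)) - (A * Aᵀ - Q * (A * Aᵀ)) * Qᵀ := by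
        simp only [Matrix.transpose_sub, Matrix.transpose_mul, Matrix.mul_sub, Matrix.sub_mul,
          Matrix.mul_assoc]
      rw [this, hQS]; simp
    rw [← Matrix.conjTranspose_eq_transpose_of_trivial, Matrix.self_mul_conjTranspose_eq_zero,
      sub_eq_zero] at h0
    exact h0.symm
  refine ⟨Aᵀ * G, ?_, ?_, ?_, ?_⟩
  · rw [← Matrix.mul_assoc, hSG, hQA]
  · rw [Matrix.mul_assoc, ← Matrix.mul_assoc A, hSG, Matrix.mul_assoc, hGQ]
  · rw [← Matrix.mul_assoc, hSG, hQ, ktr]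
  · rw [Matrix.transpose_mul, Matrix.transpose_mul, Matrix.transpose_transpose,
      show Gᵀ = G from ktr _, Matrix.mul_assoc Aᵀ G A]

/-- The Moore-Penrose pseudo-inverse `A†`. -/
def pseudoInverse (A : Matrix m p ℝ) : Matrix p m ℝ := (exists_isPseudoInverse A).choose

/-- An orthonormal basis `u_s` of left singular vectors of `J` (eigenvectors of `J Jᵀ`). -/
def leftSingularVector (J : Matrix m p ℝ) (s : m) : EuclideanSpace ℝ m :=
  (Matrix.isHermitian_mul_conjTranspose_self J).eigenvectorBasis s

/-- The singular value `λ_s` of `J` that belongs to `u_s`. -/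
def singularValue (J : Matrix m p ℝ) (s : m) : ℝ :=
  √((Matrix.isHermitian_mul_conjTranspose_self J).eigenvalues s)

/-- The right singular vector `v_s = Jᵀ u_s / λ_s`, for `λ_s > 0`. -/
def rightSingularVector (J : Matrix m p ℝ) (s : m) : p → ℝ :=
  (singularValue J s)⁻¹ • (Jᵀ *ᵥ (leftSingularVector J s).ofLp)

/-- The information space: the span of the left singular vectors with `λ_s ≥ α`. -/
def infoSpace (J : Matrix m p ℝ) (α : ℝ) : Submodule ℝ (EuclideanSpace ℝ m) :=
  Submodule.span ℝ (leftSingularVector J '' {s | α ≤ singularValue J s})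

/-- The nuisance space: the span of the left singular vectors with `λ_s < α`. -/
def nuisanceSpace (J : Matrix m p ℝ) (α : ℝ) : Submodule ℝ (EuclideanSpace ℝ m) :=
  Submodule.span ℝ (leftSingularVector J '' {s | singularValue J s < α})

open Classical in
/-- The truncated matrix `J_I = ∑_{λ_s ≥ α} λ_s u_s v_sᵀ` (for a cut-off `α > 0`). -/
def truncated (J : Matrix m p ℝ) (α : ℝ) : Matrix m p ℝ :=
  ∑ s with α ≤ singularValue J s, singularValue J s •
    Matrix.vecMulVec (leftSingularVector J s).ofLp (rightSingularVector J s)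

end LinearAlgebra

/-! ### The one-hidden-layer network, its training and its classification error -/

section Network

variable {n d k K : ℕ}

/-- A feature/label pair in `ℝ^d × ℝ^K`. -/
abbrev Example (d K : ℕ) := EuclideanSpace ℝ (Fin d) × EuclideanSpace ℝ (Fin K)

/-- Input weights `W ∈ ℝ^{k × d}` with the Frobenius inner product, i.e. `vect(W) ∈ ℝ^{kd}`. -/
abbrev Weights (k d : ℕ) := EuclideanSpace ℝ (Fin k × Fin d)

/-- `v` is one of the standard basis vectors `e_1, …, e_K`. -/
def IsOneHot (v : EuclideanSpace ℝ (Fin K)) : Prop := ∃ l, v = EuclideanSpace.single l 1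

/-- The network `f(x; W) = V φ(W x)`. -/
def net (V : Matrix (Fin K) (Fin k) ℝ) (φ : ℝ → ℝ) (W : Weights k d)
    (x : EuclideanSpace ℝ (Fin d)) : EuclideanSpace ℝ (Fin K) :=
  WithLp.toLp 2 fun l => ∑ s, V l s * φ (∑ j, W (s, j) * x j)

/-- The concatenated predictions `f(W) ∈ ℝ^{nK}` on the sample `S`. -/
def predictions (V : Matrix (Fin K) (Fin k) ℝ) (φ : ℝ → ℝ) (S : Fin n → Example d K)
    (W : Weights k d) : EuclideanSpace ℝ (Fin n × Fin K) :=
  WithLp.toLp 2 fun q => net V φ W (S q.1).1 q.2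

/-- The concatenated labels `y ∈ ℝ^{nK}` of the sample `S`. -/
def labels (S : Fin n → Example d K) : EuclideanSpace ℝ (Fin n × Fin K) :=
  WithLp.toLp 2 fun q => (S q.1).2 q.2

/-- The residual `f(W) - y ∈ ℝ^{nK}`. -/
def residual (V : Matrix (Fin K) (Fin k) ℝ) (φ : ℝ → ℝ) (S : Fin n → Example d K)
    (W : Weights k d) : EuclideanSpace ℝ (Fin n × Fin K) :=
  predictions V φ S W - labels S

/-- The training loss `L(W) = (1/2) ∑ᵢ ‖V φ(W xᵢ) - yᵢ‖²`. -/
def loss (V : Matrix (Fin K) (Fin k) ℝ) (φ : ℝ → ℝ) (S : Fin n → Example d K)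
    (W : Weights k d) : ℝ :=
  1 / 2 * ∑ i, ‖net V φ W (S i).1 - (S i).2‖ ^ 2

/-- The gradient descent iterates `W_{τ+1} = W_τ - η ∇L(W_τ)` started at `W₀`. -/
def gradDescent (V : Matrix (Fin K) (Fin k) ℝ) (φ : ℝ → ℝ) (S : Fin n → Example d K)
    (η : ℝ) (W₀ : Weights k d) : ℕ → Weights k d
  | 0 => W₀
  | τ + 1 => gradDescent V φ S η W₀ τ
      - η • gradient (loss V φ S) (gradDescent V φ S η W₀ τ)

/-- The Jacobian `𝒥(W) ∈ ℝ^{nK × kd}` of `W ↦ f(W)`. -/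
def jacobian (V : Matrix (Fin K) (Fin k) ℝ) (φ : ℝ → ℝ) (S : Fin n → Example d K)
    (W : Weights k d) : Matrix (Fin n × Fin K) (Fin k × Fin d) ℝ :=
  Matrix.of fun q r => fderiv ℝ (predictions V φ S) W (EuclideanSpace.single r 1) q

/-- The data matrix `X ∈ ℝ^{n × d}`, whose rows are the inputs. -/
def dataMatrix (S : Fin n → Example d K) : Matrix (Fin n) (Fin d) ℝ :=
  Matrix.of fun i j => (S i).1 j

/-- The set of indices at which `v` is maximal. -/
def argmaxSet (v : EuclideanSpace ℝ (Fin K)) : Set (Fin K) := {l | ∀ j, v j ≤ v l}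

/-- The classification error `Err(W) = ℙ(argmax y ≠ argmax f(x; W))` for `(x, y) ∼ D`. For a
one-hot label, a tie in `f(x; W)` at the maximum counts as an error. -/
def classError (D : Measure (Example d K)) (V : Matrix (Fin K) (Fin k) ℝ) (φ : ℝ → ℝ)
    (W : Weights k d) : ℝ :=
  D.real {z | argmaxSet z.2 ≠ argmaxSet (net V φ W z.1)}

/-- The spectral cut-off `α = ν B ᾱ n^{1/4} ‖X‖^{1/2}`. -/
def cutoff (ν B a : ℝ) (S : Fin n → Example d K) : ℝ :=
  ν * B * a * (n : ℝ) ^ (1 / 4 : ℝ) * √‖dataMatrix S‖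

end Network

end NNGen

end

/-!
Gradient descent on a wide one-hidden-layer network follows the gradient descent of its
linearisation at `W₀`, and the linearised class has a Rademacher complexity that depends neither
on the width `k` nor on the number of classes `K`.

*Optimisation.* With `A` the Jacobian at `W₀` and `β = ν B ‖X‖`, all Jacobians have norm at most `β`
and are `β / √k`-Lipschitz in `W`. As long as the weights stay within `R = 2 √Γ C_r √n / α` of `W₀`,
the residual obeys `r_{t+1} = (1 - η A A*) r_t + e_t` with `‖e_t‖ ≤ 2 η β (β R / √k) ‖r_t‖`. The energy
`‖r_t‖² + η ∑ ‖A* r_s‖²` bounds the distance travelled by `√(η t)` times the initial residual and the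
perturbations. At time `Γ / α²` this is smaller than the trivial bound `η t β` by a factor of at
least `√Γ`, and it closes the bootstrap (`gradientDescent_near_linear`). In the basis of left
singular vectors the linear iteration is explicit: after time `Γ / α²` the residual has decayed by
`exp (-Γ)` on the information space (`norm_linearIter_le`), and the weights have moved by at most
`‖J_I† r₀‖ + (Γ / α) ‖Π_N r₀‖` (`norm_sum_adjoint_linearIter_le`). The width condition makes all
errors `O(ζ)` (`width_scales`); together these give `training_bounds`.

*Generalisation.* A misclassified one-hot example has `√2 ‖f - y‖ ≥ 1`, so the error is at most the
expectation of `min 1 (√2 ‖f - y‖)`. Up to the second-order remainder `ν B ‖U‖² / √k = O(ζ)`, with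
`U = W - W₀`, the network may be replaced by its linearisation, whose loss is `surrogate`. For the
linearised class, samples are replaced one at a time by random linear forms: symmetrisation and
Khintchine's inequality give the one-step bound `integral_sup'_le_integral_signAvg`, and induction
over the sample the expected deviation `integral_sup'_deviation_le`. McDiarmid's inequality
(`integral_exp_le_of_bounded_differences`) turns it into a tail bound. Since the final radius
`‖U‖` depends on the sample, a union bound over radii `j / (2 ν B)` with failure probabilities
`δ / 2 ^ j` follows (`measure_exists_deviation_gt_norm_le`); its cost `√(j / n)` is absorbed by the term
linear in `‖U‖`.
-/

noncomputable section

namespace NNGen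

/-! ### Random signs and Khintchine's inequality -/

section Signs

/-- The sign `±1` encoded by a Boolean. -/
def boolSign (b : Bool) : ℝ := if b then 1 else -1

/-- The expectation of `F ε` over uniformly random signs `ε ∈ {±1}^K`. -/
def signAvg {K : ℕ} (F : (Fin K → Bool) → ℝ) : ℝ := (∑ ε, F ε) / 2 ^ K

theorem signAvg_zero (F : (Fin 0 → Bool) → ℝ) : signAvg F = F ![] := by
  simp [signAvg, Subsingleton.elim default ![]]

theorem signAvg_succ {K : ℕ} (F : (Fin (K + 1) → Bool) → ℝ) :
    signAvg F = signAvg fun ε : Fin K → Bool =>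
      (F (Fin.cons true ε) + F (Fin.cons false ε)) / 2 := by
  have h : ∑ ε, F ε
      = ∑ ε : Fin K → Bool, (F (Fin.cons true ε) + F (Fin.cons false ε)) := by
    rw [← (Fin.consEquiv fun _ : Fin (K + 1) => Bool).sum_comp, Fintype.sum_prod_type,
      Fintype.sum_bool, ← Finset.sum_add_distrib]
    rfl
  rw [signAvg, signAvg, h, ← Finset.sum_div, pow_succ]
  field_simp

theorem signAvg_mono {K : ℕ} {F G : (Fin K → Bool) → ℝ} (h : ∀ ε, F ε ≤ G ε) :
    signAvg F ≤ signAvg G := by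
  unfold signAvg
  gcongr with ε
  exact h ε

theorem signAvg_add {K : ℕ} (F G : (Fin K → Bool) → ℝ) :
    signAvg (fun ε => F ε + G ε) = signAvg F + signAvg G := by
  simp [signAvg, Finset.sum_add_distrib, add_div]

theorem signAvg_sub {K : ℕ} (F G : (Fin K → Bool) → ℝ) :
    signAvg (fun ε => F ε - G ε) = signAvg F - signAvg G := by
  simp [signAvg, Finset.sum_sub_distrib, sub_div]

theorem signAvg_const_mul {K : ℕ} (c : ℝ) (F : (Fin K → Bool) → ℝ) :
    signAvg (fun ε => c * F ε) = c * signAvg F := by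
  simp [signAvg, ← Finset.mul_sum, mul_div_assoc]

theorem signAvg_const {K : ℕ} (c : ℝ) : signAvg (fun _ : Fin K → Bool => c) = c := by
  simp [signAvg]

/-- Random signs are symmetric: `ε` and `-ε` have the same law. -/
theorem signAvg_not {K : ℕ} (F : (Fin K → Bool) → ℝ) :
    signAvg (fun ε => F fun l => !ε l) = signAvg F := by
  unfold signAvg
  congr 1
  exact Equiv.sum_comp (Equiv.piCongrRight fun _ : Fin K => Equiv.boolNot) F

theorem boolSign_not (b : Bool) : boolSign (!b) = -boolSign b := by cases b <;> simp [boolSign]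

/-- The random combination `∑ ε_l v_l`. -/
def signSum {K : ℕ} {H : Type*} [AddCommGroup H] [Module ℝ H] (v : Fin K → H)
    (ε : Fin K → Bool) : H := ∑ l, boolSign (ε l) • v l

theorem signSum_not {K : ℕ} {H : Type*} [AddCommGroup H] [Module ℝ H] (v : Fin K → H)
    (ε : Fin K → Bool) : signSum v (fun l => !ε l) = -signSum v ε := by
  simp [signSum, boolSign_not]

theorem signSum_cons_true {K : ℕ} {H : Type*} [AddCommGroup H] [Module ℝ H]
    (v : Fin (K + 1) → H) (ε : Fin K → Bool) :
    signSum v (Fin.cons true ε) = v 0 + signSum (fun l => v l.succ) ε := by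
  simp [signSum, Fin.sum_univ_succ, boolSign]

theorem signSum_cons_false {K : ℕ} {H : Type*} [AddCommGroup H] [Module ℝ H]
    (v : Fin (K + 1) → H) (ε : Fin K → Bool) :
    signSum v (Fin.cons false ε) = -v 0 + signSum (fun l => v l.succ) ε := by
  simp [signSum, Fin.sum_univ_succ, boolSign]

theorem signAvg_norm_add_signSum_sq {H : Type*} [NormedAddCommGroup H] [InnerProductSpace ℝ H]
    {K : ℕ} (v : Fin K → H) (g : H) :
    signAvg (fun ε => ‖g + signSum v ε‖ ^ 2) = ‖g‖ ^ 2 + ∑ l, ‖v l‖ ^ 2 := by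
  induction K generalizing g with
  | zero => simp [signAvg_zero, signSum]
  | succ K ih =>
    rw [signAvg_succ]
    have h : ∀ ε : Fin K → Bool, (‖g + signSum v (Fin.cons true ε)‖ ^ 2
        + ‖g + signSum v (Fin.cons false ε)‖ ^ 2) / 2
        = ‖g + signSum (fun l => v l.succ) ε‖ ^ 2 + ‖v 0‖ ^ 2 := by
      intro ε
      rw [signSum_cons_true, signSum_cons_false]
      have := parallelogram_law_with_norm ℝ (g + signSum (fun l => v l.succ) ε) (v 0)
      rw [show g + (v 0 + signSum (fun l => v l.succ) ε)
        = g + signSum (fun l => v l.succ) ε + v 0 by abel,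
        show g + (-v 0 + signSum (fun l => v l.succ) ε)
        = g + signSum (fun l => v l.succ) ε - v 0 by abel]
      nlinarith
    simp only [h]
    rw [signAvg_add, signAvg_const, ih, Fin.sum_univ_succ]
    ring

theorem signAvg_signSum_sq {K : ℕ} (v : Fin K → ℝ) :
    signAvg (fun ε => signSum v ε ^ 2) = ∑ l, v l ^ 2 := by
  simpa using signAvg_norm_add_signSum_sq v 0

theorem signAvg_signSum_pow_four_le {K : ℕ} (v : Fin K → ℝ) :
    signAvg (fun ε => signSum v ε ^ 4) ≤ 3 * (∑ l, v l ^ 2) ^ 2 := by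
  induction K with
  | zero => simp [signAvg_zero, signSum]
  | succ K ih =>
    rw [signAvg_succ]
    have h : ∀ ε : Fin K → Bool, (signSum v (Fin.cons true ε) ^ 4
        + signSum v (Fin.cons false ε) ^ 4) / 2
        = signSum (fun l => v l.succ) ε ^ 4
          + (6 * v 0 ^ 2 * signSum (fun l => v l.succ) ε ^ 2 + v 0 ^ 4) := by
      intro ε
      rw [signSum_cons_true, signSum_cons_false]
      ring
    simp only [h]
    rw [signAvg_add, signAvg_add, signAvg_const, signAvg_const_mul, signAvg_signSum_sq,
      Fin.sum_univ_succ]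
    nlinarith [ih fun l => v l.succ, sq_nonneg (v 0 ^ 2)]

/-- **Khintchine's inequality** with constant `√3`. With `σ² = ∑ v_l²`, it is the average of the
elementary bound `9 σ² x² - x⁴ ≤ 6 √3 σ³ |x|` over `x = ∑ ε_l v_l`. -/
theorem sqrt_sum_sq_le_signAvg_abs {K : ℕ} (v : Fin K → ℝ) :
    √(∑ l, v l ^ 2) ≤ √3 * signAvg (fun ε => |signSum v ε|) := by
  set σ := √(∑ l, v l ^ 2) with hσ
  have hsum : ∑ l, v l ^ 2 = σ ^ 2 := (Real.sq_sqrt (by positivity)).symm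
  have hσ0 : 0 ≤ σ := Real.sqrt_nonneg _
  rcases hσ0.eq_or_lt with h0 | hpos
  · rw [← h0]
    have : 0 ≤ signAvg (fun ε => |signSum v ε|) := by unfold signAvg; positivity
    positivity
  have h3 : √3 ^ 2 = 3 := Real.sq_sqrt (by norm_num)
  have h30 : 0 < √3 := by positivity
  -- The polynomial bound, from `(y - √3)² (y + 2√3) ≥ 0` for `y = |x| / σ ≥ 0`.
  have key : ∀ x : ℝ, 9 * σ ^ 2 * x ^ 2 - x ^ 4 ≤ 6 * √3 * σ ^ 3 * |x| := by
    intro x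
    have h : 0 ≤ |x| * ((|x| - √3 * σ) ^ 2 * (|x| + 2 * √3 * σ)) := by positivity
    have e : |x| * ((|x| - √3 * σ) ^ 2 * (|x| + 2 * √3 * σ))
        = (|x| ^ 2) ^ 2 - 3 * √3 ^ 2 * σ ^ 2 * |x| ^ 2 + 2 * √3 ^ 2 * √3 * σ ^ 3 * |x| := by ring
    rw [e, h3, sq_abs] at h
    nlinarith
  have havg := signAvg_mono (K := K) fun ε => key (signSum v ε)
  have e1 : signAvg (fun ε => 9 * σ ^ 2 * signSum v ε ^ 2 - signSum v ε ^ 4)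
      = 9 * σ ^ 2 * σ ^ 2 - signAvg (fun ε => signSum v ε ^ 4) := by
    rw [signAvg_sub, signAvg_const_mul, signAvg_signSum_sq, hsum]
  rw [e1, signAvg_const_mul] at havg
  have h4 := signAvg_signSum_pow_four_le v
  rw [hsum] at h4
  have h6 : σ ^ 3 * σ ≤ σ ^ 3 * (√3 * signAvg (fun ε => |signSum v ε|)) := by nlinarith
  exact le_of_mul_le_mul_left h6 (by positivity)

end Signs

/-! ### Symmetrisation and vector contraction, one sample at a time -/

section Contraction

variable {ι H : Type*} [NormedAddCommGroup H] [InnerProductSpace ℝ H] {K : ℕ}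

/-- The deterministic heart of the contraction principle: replacing the increment
`h' - h` (symmetrised) by a random linear form. Here `h`, `h'` are the losses at two
samples, and `b`, `b'` are the vector-valued functions with respect to which they are Lipschitz. -/
theorem sup'_add_sup'_le_signAvg (s : Finset ι) (hs : s.Nonempty) (g h h' : ι → ℝ)
    (b b' : ι → Fin K → ℝ) (C : ℝ) (hC : 0 ≤ C)
    (hb : ∀ u v, 2 * √3 * |h u - h v| ≤ C * √(∑ l, (b u l - b v l) ^ 2))
    (hb' : ∀ u v, 2 * √3 * |h' u - h' v| ≤ C * √(∑ l, (b' u l - b' v l) ^ 2)) :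
    s.sup' hs (fun u => g u + (h' u - h u)) + s.sup' hs (fun u => g u + (h u - h' u))
      ≤ signAvg (fun ε => s.sup' hs fun u => g u + C * signSum (b u) ε)
        + signAvg (fun ε => s.sup' hs fun u => g u + C * signSum (b' u) ε) := by
  have step : ∀ (h : ι → ℝ) (b : ι → Fin K → ℝ),
      (∀ u v, 2 * √3 * |h u - h v| ≤ C * √(∑ l, (b u l - b v l) ^ 2)) →
      ∀ u ∈ s, ∀ v ∈ s, g u + g v + 2 * |h u - h v|
        ≤ 2 * signAvg (fun ε => s.sup' hs fun u => g u + C * signSum (b u) ε) := by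
    intro h b hb u hu v hv
    have h1 : 2 * |h u - h v| ≤ C * signAvg (fun ε => |signSum (fun l => b u l - b v l) ε|) := by
      have hk := sqrt_sum_sq_le_signAvg_abs fun l => b u l - b v l
      have h30 : 0 < √3 := by positivity
      have := (hb u v).trans (mul_le_mul_of_nonneg_left hk hC)
      refine le_of_mul_le_mul_left ?_ h30
      linarith
    have h2 : ∀ ε, g u + g v + C * |signSum (fun l => b u l - b v l) ε|
        ≤ s.sup' hs (fun u => g u + C * signSum (b u) ε)
          + s.sup' hs (fun u => g u + C * signSum (b u) fun l => !ε l) := by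
      intro ε
      have e : signSum (fun l => b u l - b v l) ε = signSum (b u) ε - signSum (b v) ε := by
        simp [signSum, mul_sub, Finset.sum_sub_distrib]
      have p1 := Finset.le_sup' (fun u => g u + C * signSum (b u) ε) hu
      have p2 := Finset.le_sup' (fun u => g u + C * signSum (b u) ε) hv
      have p3 := Finset.le_sup' (fun u => g u + C * signSum (b u) fun l => !ε l) hu
      have p4 := Finset.le_sup' (fun u => g u + C * signSum (b u) fun l => !ε l) hv
      simp only [signSum_not] at p3 p4 ⊢
      rw [e]
      rcases abs_cases (signSum (b u) ε - signSum (b v) ε) with ⟨h, -⟩ | ⟨h, -⟩ <;> rw [h] <;>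
        linarith
    have h3 := signAvg_mono h2
    rw [signAvg_add, signAvg_const, signAvg_const_mul, signAvg_add,
      signAvg_not fun ε => s.sup' hs fun u => g u + C * signSum (b u) ε] at h3
    linarith
  obtain ⟨u, hu, eu⟩ := s.exists_mem_eq_sup' hs fun u => g u + (h' u - h u)
  obtain ⟨v, hv, ev⟩ := s.exists_mem_eq_sup' hs fun u => g u + (h u - h' u)
  have s1 := step h b hb u hu v hv
  have s2 := step h' b' hb' u hu v hv
  rw [eu, ev]
  have a1 := neg_abs_le (h u - h v)
  have a2 := le_abs_self (h' u - h' v)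
  linarith

theorem abs_sup'_le {s : Finset ι} (hs : s.Nonempty) {f : ι → ℝ} {M : ℝ}
    (h : ∀ u ∈ s, |f u| ≤ M) : |s.sup' hs f| ≤ M := by
  obtain ⟨u, hu, eu⟩ := s.exists_mem_eq_sup' hs f
  rw [eu]; exact h u hu

theorem sup'_le_sup'_add {s : Finset ι} (hs : s.Nonempty) {f g : ι → ℝ} {c : ℝ}
    (h : ∀ u ∈ s, f u ≤ g u + c) : s.sup' hs f ≤ s.sup' hs g + c := by
  refine Finset.sup'_le hs _ fun u hu => (h u hu).trans ?_
  gcongr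
  exact Finset.le_sup' g hu

theorem measurable_sup' {Ω : Type*} [MeasurableSpace Ω] {s : Finset ι} (hs : s.Nonempty)
    {f : ι → Ω → ℝ} (hf : ∀ u, Measurable (f u)) : Measurable fun ω => s.sup' hs fun u => f u ω := by
  have := Finset.measurable_sup' hs (f := f) fun u _ => hf u
  convert this using 2 with ω
  rw [Finset.sup'_apply]

theorem measurable_signAvg {Ω : Type*} [MeasurableSpace Ω] {f : (Fin K → Bool) → Ω → ℝ}
    (hf : ∀ ε, Measurable (f ε)) : Measurable fun ω => signAvg fun ε => f ε ω := by
  unfold signAvg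
  exact (Finset.measurable_sum _ fun ε _ => hf ε).div_const _

theorem abs_signAvg_le {F : (Fin K → Bool) → ℝ} {M : ℝ} (h : ∀ ε, |F ε| ≤ M) :
    |signAvg F| ≤ M := by
  rw [abs_le]
  constructor
  · rw [← signAvg_const (K := K) (-M)]
    exact signAvg_mono fun ε => (abs_le.1 (h ε)).1
  · rw [← signAvg_const (K := K) M]
    exact signAvg_mono fun ε => (abs_le.1 (h ε)).2

variable {Z : Type*} [MeasurableSpace Z]

theorem integrable_of_abs_le {μ : Measure Z} [IsFiniteMeasure μ] {f : Z → ℝ} (hf : Measurable f)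
    {M : ℝ} (h : ∀ z, |f z| ≤ M) : Integrable f μ :=
  Integrable.of_bound hf.aestronglyMeasurable M (Filter.Eventually.of_forall h)

/-- One step of symmetrisation and contraction: in expectation, the centred loss of a single
sample can be traded for a random linear form, uniformly over a finite index set. -/
theorem integral_sup'_le_integral_signAvg (D : Measure Z) [IsProbabilityMeasure D]
    (s : Finset ι) (hs : s.Nonempty) (g : ι → ℝ) (h : ι → Z → ℝ) (hm : ∀ u, Measurable (h u))
    (h0 : ∀ u z, 0 ≤ h u z) (h1 : ∀ u z, h u z ≤ 1)
    (b : ι → Fin K → Z → ℝ) (hbm : ∀ u l, Measurable (b u l)) {M : ℝ}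
    (hbM : ∀ u ∈ s, ∀ l z, |b u l z| ≤ M) (C : ℝ) (hC : 0 ≤ C)
    (hb : ∀ u v z, 2 * √3 * |h u z - h v z| ≤ C * √(∑ l, (b u l z - b v l z) ^ 2)) :
    ∫ z, s.sup' hs (fun u => g u + ((∫ z', h u z' ∂D) - h u z)) ∂D
      ≤ ∫ z, signAvg (fun ε => s.sup' hs fun u => g u + C * signSum (fun l => b u l z) ε) ∂D := by
  obtain ⟨G, hG⟩ : ∃ G, ∀ u ∈ s, |g u| ≤ G :=
    ⟨s.sup' hs fun u => |g u|, fun u hu => Finset.le_sup' (fun u => |g u|) hu⟩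
  have hint : ∀ u, Integrable (h u) D := fun u =>
    integrable_of_abs_le (hm u) (M := 1) fun z => abs_le.2 ⟨by linarith [h0 u z], h1 u z⟩
  have hI0 : ∀ u, 0 ≤ ∫ z', h u z' ∂D := fun u => integral_nonneg (h0 u)
  have hI1 : ∀ u, ∫ z', h u z' ∂D ≤ 1 := fun u => by
    simpa using integral_mono (hint u) (integrable_const 1) (h1 u)
  set Q : Z → ℝ := fun z =>
    signAvg (fun ε => s.sup' hs fun u => g u + C * signSum (fun l => b u l z) ε) with hQ
  have hQint : Integrable Q D := by
    refine integrable_of_abs_le (measurable_signAvg fun ε => measurable_sup' hs fun u =>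
      measurable_const.add (Measurable.const_mul ?_ C)) (M := G + C * ∑ _l : Fin K, M) fun z =>
      abs_signAvg_le fun ε => abs_sup'_le hs fun u hu => ?_
    · exact Finset.measurable_sum _ fun l _ => (hbm u l).const_smul (boolSign (ε l))
    · refine (abs_add_le _ _).trans (add_le_add (hG u hu) ?_)
      rw [abs_mul, abs_of_nonneg hC]
      gcongr
      refine (Finset.abs_sum_le_sum_abs _ _).trans (Finset.sum_le_sum fun l _ => ?_)
      rw [smul_eq_mul, abs_mul]
      have : |boolSign (ε l)| = 1 := by cases ε l <;> simp [boolSign]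
      rw [this, one_mul]
      exact hbM u hu l z
  set Ψ : Z × Z → ℝ := fun p => s.sup' hs fun u => g u + (h u p.2 - h u p.1) with hΨ
  have hΨm : Measurable Ψ := measurable_sup' hs fun u => measurable_const.add
    (((hm u).comp measurable_snd).sub ((hm u).comp measurable_fst))
  have hΨb : ∀ p, |Ψ p| ≤ G + 1 := fun p => abs_sup'_le hs fun u hu =>
    (abs_add_le _ _).trans (add_le_add (hG u hu) (abs_le.2
      ⟨by linarith [h0 u p.2, h1 u p.1], by linarith [h0 u p.1, h1 u p.2]⟩))
  have hΨi : Integrable Ψ (D.prod D) := integrable_of_abs_le hΨm hΨb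
  have hΨi' : Integrable (fun p : Z × Z => Ψ p.swap) (D.prod D) := hΨi.swap
  have hΨz : ∀ z, Integrable (fun z' => Ψ (z, z')) D := fun z =>
    integrable_of_abs_le (hΨm.comp measurable_prodMk_left) fun z' => hΨb (z, z')
  -- Jensen: the expectation over a ghost sample leaves the supremum.
  have hstep1 : ∫ z, s.sup' hs (fun u => g u + ((∫ z', h u z' ∂D) - h u z)) ∂D
      ≤ ∫ z, ∫ z', Ψ (z, z') ∂D ∂D := by
    refine integral_mono (integrable_of_abs_le (M := G + 1) (measurable_sup' hs fun u =>
      measurable_const.add (measurable_const.sub (hm u))) fun z => abs_sup'_le hs fun u hu =>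
        (abs_add_le _ _).trans (add_le_add (hG u hu) (abs_le.2
          ⟨by linarith [hI0 u, h1 u z], by linarith [h0 u z, hI1 u]⟩)))
      hΨi.integral_prod_left fun z => ?_
    refine Finset.sup'_le hs _ fun u hu => ?_
    have e : g u + ((∫ z', h u z' ∂D) - h u z) = ∫ z', (g u + (h u z' - h u z)) ∂D := by
      have hi : Integrable (fun z' => h u z' - h u z) D := (hint u).sub (integrable_const _)
      have e' : ∫ z', (h u z' - h u z) ∂D = (∫ z', h u z' ∂D) - h u z := by
        rw [integral_sub (hint u) (integrable_const _)]; simp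
      rw [integral_add (integrable_const _) hi, e']
      simp
    rw [e]
    refine integral_mono ((integrable_const _).add ((hint u).sub (integrable_const _))) (hΨz z)
      fun z' => ?_
    exact Finset.le_sup' (fun u => g u + (h u z' - h u z)) hu
  rw [← integral_prod _ hΨi] at hstep1
  have hswap : ∫ p, Ψ p.swap ∂(D.prod D) = ∫ p, Ψ p ∂(D.prod D) := integral_prod_swap Ψ
  have hQ1 : Integrable (fun p : Z × Z => Q p.1) (D.prod D) := hQint.comp_fst D
  have hQ2 : Integrable (fun p : Z × Z => Q p.2) (D.prod D) := hQint.comp_snd D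
  have hsum : ∫ p, (Ψ p + Ψ p.swap) ∂(D.prod D) ≤ ∫ p : Z × Z, (Q p.1 + Q p.2) ∂(D.prod D) := by
    refine integral_mono (hΨi.add hΨi') (hQ1.add hQ2) fun p => ?_
    exact sup'_add_sup'_le_signAvg s hs g (fun u => h u p.1) (fun u => h u p.2)
      (fun u l => b u l p.1) (fun u l => b u l p.2) C hC (fun u v => hb u v p.1)
      fun u v => hb u v p.2
  rw [integral_add hΨi hΨi', integral_add hQ1 hQ2, hswap] at hsum
  have e1 : ∫ p : Z × Z, Q p.1 ∂(D.prod D) = ∫ z, Q z ∂D := by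
    rw [integral_fun_fst]; simp
  have e2 : ∫ p : Z × Z, Q p.2 ∂(D.prod D) = ∫ z, Q z ∂D := by
    rw [integral_fun_snd]; simp
  linarith

end Contraction

/-! ### McDiarmid's inequality -/

section Product

variable {Z : Type*} [MeasurableSpace Z] {n : ℕ}

theorem measurable_finCons :
    Measurable fun p : Z × (Fin n → Z) => (Fin.cons p.1 p.2 : Fin (n + 1) → Z) := by
  refine measurable_pi_iff.2 fun i => ?_
  refine Fin.cases ?_ (fun j => ?_) i
  · simpa using measurable_fst
  · simp only [Fin.cons_succ]
    exact (measurable_pi_apply j).comp measurable_snd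

theorem integral_pi_succ (D : Measure Z) [IsProbabilityMeasure D] (f : (Fin (n + 1) → Z) → ℝ) :
    ∫ S, f S ∂(Measure.pi fun _ => D)
      = ∫ p : Z × (Fin n → Z), f (Fin.cons p.1 p.2) ∂(D.prod (Measure.pi fun _ => D)) := by
  have h := (measurePreserving_piFinSuccAbove (fun _ : Fin (n + 1) => D) 0).symm
  rw [← h.integral_comp' (g := f)]
  refine integral_congr_ae (Filter.Eventually.of_forall fun p => congrArg f ?_)
  exact Fin.insertNth_zero' _ _

/-- **McDiarmid's inequality** in exponential-moment form, for a function with bounded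
differences `c`. -/
theorem integral_exp_le_of_bounded_differences (D : Measure Z) [IsProbabilityMeasure D] {c : ℝ}
    (t : ℝ) {M : ℝ} (f : (Fin n → Z) → ℝ) (hf : Measurable f) (hM : ∀ S, |f S| ≤ M)
    (hd : ∀ S i z, |f S - f (Function.update S i z)| ≤ c) :
    ∫ S, Real.exp (t * f S) ∂(Measure.pi fun _ => D)
      ≤ Real.exp (t * (∫ S, f S ∂(Measure.pi fun _ => D)) + n * (c ^ 2 * t ^ 2 / 8)) := by
  induction n with
  | zero =>
    have : ∀ S : Fin 0 → Z, f S = f ![] := fun S => congrArg f (Subsingleton.elim _ _)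
    simp [this]
  | succ n ih =>
    set P : Measure (Fin n → Z) := Measure.pi fun _ => D
    set F : Z × (Fin n → Z) → ℝ := fun p => f (Fin.cons p.1 p.2) with hF
    have hFm : Measurable F := hf.comp measurable_finCons
    have hFM : ∀ p, |F p| ≤ M := fun p => hM _
    have hexpM : ∀ x : ℝ, |x| ≤ M → |Real.exp (t * x)| ≤ Real.exp (|t| * M) := by
      intro x hx
      rw [abs_of_pos (Real.exp_pos _)]
      refine Real.exp_le_exp.2 ((le_abs_self _).trans ?_)
      rw [abs_mul]; gcongr
    have hEint : Integrable (fun p => Real.exp (t * F p)) (D.prod P) :=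
      integrable_of_abs_le (by fun_prop) fun p => hexpM _ (hFM p)
    have hFint : Integrable F (D.prod P) := integrable_of_abs_le hFm hFM
    set f₁ : (Fin n → Z) → ℝ := fun S => ∫ z, F (z, S) ∂D with hf₁
    have hFS : ∀ S, Integrable (fun z => F (z, S)) D := fun S =>
      integrable_of_abs_le (hFm.comp measurable_prodMk_right) fun z => hFM _
    have hf₁m : Measurable f₁ :=
      (hFm.stronglyMeasurable.integral_prod_left' (μ := D)).measurable
    have habs : ∀ {X : Z → ℝ} {m : ℝ}, (∀ z, |X z| ≤ m) → |∫ z, X z ∂D| ≤ m := by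
      intro X m hX
      have := norm_integral_le_of_norm_le_const (μ := D) (f := X) (C := m)
        (Filter.Eventually.of_forall fun z => hX z)
      simpa using this
    have hf₁M : ∀ S, |f₁ S| ≤ M := fun S => habs fun z => hFM _
    have hf₁d : ∀ S i z, |f₁ S - f₁ (Function.update S i z)| ≤ c := by
      intro S i z
      rw [hf₁]
      simp only
      rw [← integral_sub (hFS _) (hFS _)]
      refine habs fun z' => ?_
      simp only [hF, Fin.cons_update]
      exact hd _ _ _
    rw [integral_pi_succ, integral_pi_succ, integral_prod_symm _ hEint, integral_prod_symm _ hFint]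
    -- Hoeffding's lemma in the first coordinate.
    have hoeff : ∀ S, ∫ z, Real.exp (t * F (z, S)) ∂D
        ≤ Real.exp (c ^ 2 * t ^ 2 / 8) * Real.exp (t * f₁ S) := by
      intro S
      have : Nonempty Z := nonempty_of_isProbabilityMeasure D
      set a := ⨅ z, F (z, S) with ha
      have hbdd : BddBelow (Set.range fun z => F (z, S)) :=
        ⟨-M, by rintro _ ⟨z, rfl⟩; exact (abs_le.1 (hFM _)).1⟩
      have hmem : ∀ z, F (z, S) ∈ Set.Icc a (a + c) := by
        intro z
        refine ⟨ciInf_le hbdd z, ?_⟩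
        rw [← sub_le_iff_le_add]
        refine le_ciInf fun z' => ?_
        have := hd (Fin.cons z S) 0 z'
        rw [Fin.update_cons_zero] at this
        have h2 := (abs_le.1 this).2
        simp only [hF]
        linarith
      have hs := ProbabilityTheory.hasSubgaussianMGF_of_mem_Icc
        (X := fun z => F (z, S)) (μ := D)
        (hFm.comp measurable_prodMk_right).aemeasurable (Filter.Eventually.of_forall hmem)
      have hm := hs.mgf_le t
      unfold ProbabilityTheory.mgf at hm
      have e : ∀ z, Real.exp (t * F (z, S))
          = Real.exp (t * f₁ S) * Real.exp (t * (F (z, S) - f₁ S)) := by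
        intro z; rw [← Real.exp_add]; ring_nf
      simp only [e]
      rw [integral_const_mul, mul_comm]
      gcongr
      refine hm.trans (le_of_eq ?_)
      congr 1
      simp only [add_sub_cancel_left, NNReal.coe_pow, NNReal.coe_div, coe_nnnorm,
        Real.norm_eq_abs, sq_abs, div_pow, NNReal.coe_ofNat]
      ring
    calc ∫ S, ∫ z, Real.exp (t * F (z, S)) ∂D ∂P
        ≤ ∫ S, Real.exp (c ^ 2 * t ^ 2 / 8) * Real.exp (t * f₁ S) ∂P := by
          refine integral_mono hEint.integral_prod_right ?_ hoeff
          exact (integrable_of_abs_le (by fun_prop) fun S => hexpM _ (hf₁M S)).const_mul _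
      _ ≤ Real.exp (c ^ 2 * t ^ 2 / 8)
            * Real.exp (t * (∫ S, f₁ S ∂P) + n * (c ^ 2 * t ^ 2 / 8)) := by
          rw [integral_const_mul]
          gcongr
          exact ih f₁ hf₁m hf₁M hf₁d
      _ = _ := by
          rw [← Real.exp_add]
          congr 1
          push_cast
          ring

end Product

/-! ### Expected uniform deviation of linear classes -/

section Complexity

variable {H : Type*} [NormedAddCommGroup H] [InnerProductSpace ℝ H] [MeasurableSpace H]
  [BorelSpace H] [SecondCountableTopology H] {K : ℕ} {Z : Type*} [MeasurableSpace Z]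

theorem signAvg_sqrt_le {f : (Fin K → Bool) → ℝ} (hf : ∀ ε, 0 ≤ f ε) :
    signAvg (fun ε => √(f ε)) ≤ √(signAvg f) := by
  refine Real.le_sqrt_of_sq_le ?_
  have h := sq_sum_le_card_mul_sum_sq (s := Finset.univ) (f := fun ε => √(f ε))
  simp only [Finset.card_univ, Fintype.card_fun, Fintype.card_fin, Fintype.card_bool,
    Nat.cast_pow, Nat.cast_ofNat, Real.sq_sqrt (hf _)] at h
  rw [signAvg, signAvg, div_pow, div_le_div_iff₀ (by positivity) (by positivity)]
  nlinarith [show (0:ℝ) < 2 ^ K by positivity]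

open scoped RealInnerProductSpace

/-- Expected uniform deviation of a class of losses, each Lipschitz in the linear
predictions `u ↦ (⟪a_l z, u⟫)_l`. The vector `G` collects the random linear forms that have already
replaced samples in the induction. -/
theorem integral_sup'_deviation_le (D : Measure Z) [IsProbabilityMeasure D]
    (s : Finset H) (hs : s.Nonempty) {R : ℝ} (hR : 0 ≤ R) (hsR : ∀ u ∈ s, ‖u‖ ≤ R)
    (a : Fin K → Z → H) (ham : ∀ l, Measurable (a l)) {F : ℝ} (hF : 0 ≤ F)
    (haF : ∀ z, ∑ l, ‖a l z‖ ^ 2 ≤ F ^ 2)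
    (h : H → Z → ℝ) (hm : ∀ u, Measurable (h u)) (h0 : ∀ u z, 0 ≤ h u z) (h1 : ∀ u z, h u z ≤ 1)
    {C : ℝ} (hC : 0 ≤ C)
    (hb : ∀ u v z, 2 * √3 * |h u z - h v z| ≤ C * √(∑ l, (⟪a l z, u⟫ - ⟪a l z, v⟫) ^ 2))
    (n : ℕ) (G : H) :
    ∫ S : Fin n → Z, s.sup' hs (fun u => ⟪G, u⟫ + ∑ i, ((∫ z, h u z ∂D) - h u (S i)))
        ∂(Measure.pi fun _ => D)
      ≤ R * √(‖G‖ ^ 2 + n * (C ^ 2 * F ^ 2)) := by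
  have hint : ∀ u, Integrable (h u) D := fun u =>
    integrable_of_abs_le (hm u) (M := 1) fun z => abs_le.2 ⟨by linarith [h0 u z], h1 u z⟩
  have hI0 : ∀ u, 0 ≤ ∫ z', h u z' ∂D := fun u => integral_nonneg (h0 u)
  have hI1 : ∀ u, ∫ z', h u z' ∂D ≤ 1 := fun u => by
    simpa using integral_mono (hint u) (integrable_const 1) (h1 u)
  have hdev : ∀ u z, |(∫ z, h u z ∂D) - h u z| ≤ 1 := fun u z => abs_le.2
    ⟨by linarith [hI0 u, h1 u z], by linarith [h0 u z, hI1 u]⟩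
  have hal : ∀ l z, ‖a l z‖ ≤ F := fun l z => by
    refine abs_le_of_sq_le_sq' ?_ hF |>.2
    exact (Finset.single_le_sum (f := fun l => ‖a l z‖ ^ 2) (fun _ _ => by positivity)
      (Finset.mem_univ l)).trans (haF z)
  induction n generalizing G with
  | zero =>
    simp only [Finset.univ_eq_empty, Finset.sum_empty, add_zero, integral_const, probReal_univ,
      one_smul, CharP.cast_eq_zero, zero_mul, Real.sqrt_sq (norm_nonneg G)]
    refine Finset.sup'_le hs _ fun u hu => (real_inner_le_norm _ _).trans ?_
    rw [mul_comm]
    gcongr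
    exact hsR u hu
  | succ n ih =>
    set P : Measure (Fin n → Z) := Measure.pi fun _ => D
    have hdevS : ∀ (S : Fin n → Z) u, |∑ i, ((∫ z, h u z ∂D) - h u (S i))| ≤ n := by
      intro S u
      refine (Finset.abs_sum_le_sum_abs _ _).trans ?_
      simpa using Finset.sum_le_sum fun (i : Fin n) (_ : i ∈ Finset.univ) => hdev u (S i)
    have hin : ∀ G' : H, ∀ u ∈ s, |⟪G', u⟫| ≤ ‖G'‖ * R := fun G' u hu =>
      (abs_real_inner_le_norm _ _).trans (by gcongr; exact hsR u hu)
    have hss : ∀ z ε, ‖signSum (fun l => a l z) ε‖ ≤ K * F := by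
      intro z ε
      refine (norm_sum_le _ _).trans ?_
      refine (Finset.sum_le_sum fun l _ => (?_ : _ ≤ F)).trans (by simp)
      rw [norm_smul]
      have : ‖boolSign (ε l)‖ = 1 := by cases ε l <;> simp [boolSign]
      rw [this, one_mul]
      exact hal l z
    have hssm : ∀ ε, Measurable fun z => signSum (fun l => a l z) ε := fun ε =>
      Finset.measurable_sum _ fun l _ => (ham l).const_smul _
    have hsumm : ∀ u, Measurable fun S : Fin n → Z => ∑ i, ((∫ z, h u z ∂D) - h u (S i)) := fun u =>
      Finset.measurable_sum _ fun i _ => measurable_const.sub ((hm u).comp (measurable_pi_apply i))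
    -- `Y` is the supremum with the first sample split off, `Y'` the one with a random linear form.
    set Y : Z × (Fin n → Z) → ℝ := fun p => s.sup' hs fun u =>
      (⟪G, u⟫ + ∑ i, ((∫ z, h u z ∂D) - h u (p.2 i))) + ((∫ z, h u z ∂D) - h u p.1) with hY
    set Y' : (Fin K → Bool) → Z × (Fin n → Z) → ℝ := fun ε p => s.sup' hs fun u =>
      ⟪G + C • signSum (fun l => a l p.1) ε, u⟫ + ∑ i, ((∫ z, h u z ∂D) - h u (p.2 i)) with hY'
    have hYm : Measurable Y := measurable_sup' hs fun u => (measurable_const.add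
      ((hsumm u).comp measurable_snd)).add (measurable_const.sub ((hm u).comp measurable_fst))
    have hYi : Integrable Y (D.prod P) := by
      refine integrable_of_abs_le hYm (M := ‖G‖ * R + n + 1) fun p => abs_sup'_le hs fun u hu => ?_
      exact (abs_add_le _ _).trans (add_le_add ((abs_add_le _ _).trans
        (add_le_add (hin G u hu) (hdevS _ u))) (hdev u _))
    have hY'm : ∀ ε, Measurable (Y' ε) := fun ε => measurable_sup' hs fun u =>
      ((measurable_const.add (((hssm ε).comp measurable_fst).const_smul C)).inner
        measurable_const).add ((hsumm u).comp measurable_snd)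
    have hY'b : ∀ ε p, |Y' ε p| ≤ (‖G‖ + C * (K * F)) * R + n := fun ε p => by
      refine abs_sup'_le hs fun u hu => (abs_add_le _ _).trans (add_le_add ?_ (hdevS _ u))
      refine (hin _ u hu).trans ?_
      gcongr
      refine (norm_add_le _ _).trans ?_
      rw [norm_smul, Real.norm_of_nonneg hC]
      gcongr
      exact hss _ _
    have hAvi : Integrable (fun p => signAvg fun ε => Y' ε p) (D.prod P) :=
      integrable_of_abs_le (measurable_signAvg hY'm) fun p => abs_signAvg_le fun ε => hY'b ε p
    have hstep : ∀ S : Fin n → Z, ∫ z, Y (z, S) ∂D ≤ ∫ z, signAvg (fun ε => Y' ε (z, S)) ∂D := by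
      intro S
      have := integral_sup'_le_integral_signAvg D s hs
        (fun u => ⟪G, u⟫ + ∑ i, ((∫ z, h u z ∂D) - h u (S i))) h hm h0 h1
        (fun u l z => ⟪a l z, u⟫) (fun u l => (ham l).inner measurable_const) (M := F * R)
        (fun u hu l z => (abs_real_inner_le_norm _ _).trans
          (mul_le_mul (hal l z) (hsR u hu) (norm_nonneg _) hF)) C hC hb
      refine this.trans (le_of_eq ?_)
      refine integral_congr_ae (Filter.Eventually.of_forall fun z => ?_)
      simp only [hY']
      congr 1
      funext ε
      congr 1
      funext u
      simp only [inner_add_left, real_inner_smul_left, signSum, sum_inner, smul_eq_mul]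
      ring
    have hbound : ∀ z, ∫ S, signAvg (fun ε => Y' ε (z, S)) ∂P
        ≤ R * √(‖G‖ ^ 2 + (n + 1 : ℕ) * (C ^ 2 * F ^ 2)) := by
      intro z
      have e : ∫ S, signAvg (fun ε => Y' ε (z, S)) ∂P = signAvg fun ε => ∫ S, Y' ε (z, S) ∂P := by
        unfold signAvg
        rw [integral_div, integral_finsetSum]
        exact fun ε _ => integrable_of_abs_le ((hY'm ε).comp measurable_prodMk_left)
          fun S => hY'b ε _
      rw [e]
      refine (signAvg_mono fun ε => ih (G + C • signSum (fun l => a l z) ε)).trans ?_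
      rw [signAvg_const_mul]
      gcongr
      refine (signAvg_sqrt_le fun ε => by positivity).trans (Real.sqrt_le_sqrt ?_)
      have e2 : ∀ ε, C • signSum (fun l => a l z) ε = signSum (fun l => C • a l z) ε := by
        intro ε
        simp only [signSum, Finset.smul_sum]
        exact Finset.sum_congr rfl fun l _ => smul_comm _ _ _
      simp only [e2]
      rw [signAvg_add, signAvg_const, signAvg_norm_add_signSum_sq]
      simp only [norm_smul, mul_pow, ← Finset.mul_sum, Real.norm_eq_abs, sq_abs]
      push_cast
      nlinarith [mul_le_mul_of_nonneg_left (haF z) (sq_nonneg C)]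
    rw [integral_pi_succ]
    calc _ = ∫ p, Y p ∂(D.prod P) := by
          refine integral_congr_ae (Filter.Eventually.of_forall fun p => ?_)
          simp only [hY, Fin.sum_univ_succ, Fin.cons_zero, Fin.cons_succ]
          congr 1
          funext u
          ring
      _ = ∫ S, ∫ z, Y (z, S) ∂D ∂P := integral_prod_symm _ hYi
      _ ≤ ∫ S, ∫ z, signAvg (fun ε => Y' ε (z, S)) ∂D ∂P :=
          integral_mono hYi.integral_prod_right hAvi.integral_prod_right hstep
      _ = ∫ z, ∫ S, signAvg (fun ε => Y' ε (z, S)) ∂P ∂D := by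
          rw [← integral_prod_symm _ hAvi, integral_prod _ hAvi]
      _ ≤ ∫ _z, R * √(‖G‖ ^ 2 + (n + 1 : ℕ) * (C ^ 2 * F ^ 2)) ∂D :=
          integral_mono hAvi.integral_prod_left (integrable_const _) hbound
      _ = _ := by simp

end Complexity

/-! ### Uniform deviation with high probability -/

section Deviation

open scoped RealInnerProductSpace

variable {H : Type*} [NormedAddCommGroup H] [InnerProductSpace ℝ H] [MeasurableSpace H]
  [BorelSpace H] [SecondCountableTopology H] {K : ℕ} {Z : Type*} [MeasurableSpace Z]

theorem measure_sup'_deviation_gt_le (D : Measure Z) [IsProbabilityMeasure D]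
    (s : Finset H) (hs : s.Nonempty) {R : ℝ} (hR : 0 ≤ R) (hsR : ∀ u ∈ s, ‖u‖ ≤ R)
    (a : Fin K → Z → H) (ham : ∀ l, Measurable (a l)) {F : ℝ} (hF : 0 ≤ F)
    (haF : ∀ z, ∑ l, ‖a l z‖ ^ 2 ≤ F ^ 2)
    (h : H → Z → ℝ) (hm : ∀ u, Measurable (h u)) (h0 : ∀ u z, 0 ≤ h u z) (h1 : ∀ u z, h u z ≤ 1)
    {C : ℝ} (hC : 0 ≤ C)
    (hb : ∀ u v z, 2 * √3 * |h u z - h v z| ≤ C * √(∑ l, (⟪a l z, u⟫ - ⟪a l z, v⟫) ^ 2))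
    {n : ℕ} (hn : 0 < n) {t : ℝ} (ht : 0 ≤ t) :
    (Measure.pi fun _ : Fin n => D) {S | R * (C * F * √n) + t
        < s.sup' hs fun u => ∑ i, ((∫ z, h u z ∂D) - h u (S i))}
      ≤ ENNReal.ofReal (Real.exp (-2 * t ^ 2 / n)) := by
  set P : Measure (Fin n → Z) := Measure.pi fun _ => D
  have hint : ∀ u, Integrable (h u) D := fun u =>
    integrable_of_abs_le (hm u) (M := 1) fun z => abs_le.2 ⟨by linarith [h0 u z], h1 u z⟩
  have hI0 : ∀ u, 0 ≤ ∫ z', h u z' ∂D := fun u => integral_nonneg (h0 u)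
  have hI1 : ∀ u, ∫ z', h u z' ∂D ≤ 1 := fun u => by
    simpa using integral_mono (hint u) (integrable_const 1) (h1 u)
  have hdev : ∀ u z, |(∫ z, h u z ∂D) - h u z| ≤ 1 := fun u z => abs_le.2
    ⟨by linarith [hI0 u, h1 u z], by linarith [h0 u z, hI1 u]⟩
  set f : (Fin n → Z) → ℝ := fun S => s.sup' hs fun u => ∑ i, ((∫ z, h u z ∂D) - h u (S i)) with hf
  have hfm : Measurable f := measurable_sup' hs fun u => Finset.measurable_sum _ fun i _ =>
    measurable_const.sub ((hm u).comp (measurable_pi_apply i))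
  have hfM : ∀ S, |f S| ≤ n := fun S => abs_sup'_le hs fun u _ => by
    refine (Finset.abs_sum_le_sum_abs _ _).trans ?_
    simpa using Finset.sum_le_sum fun (i : Fin n) (_ : i ∈ Finset.univ) => hdev u (S i)
  have hfd : ∀ S i z, |f S - f (Function.update S i z)| ≤ 1 := by
    intro S i z
    have hu : ∀ u, |∑ j, ((∫ z, h u z ∂D) - h u (S j))
        - ∑ j, ((∫ z, h u z ∂D) - h u (Function.update S i z j))| ≤ 1 := by
      intro u
      rw [← Finset.sum_sub_distrib, Finset.sum_eq_single i]
      · simp only [Function.update_self]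
        exact abs_le.2 ⟨by linarith [h1 u (S i), h0 u z], by linarith [h0 u (S i), h1 u z]⟩
      · intro j _ hj
        rw [Function.update_of_ne hj]
        simp
      · simp
    have e1 : f S ≤ f (Function.update S i z) + 1 := sup'_le_sup'_add hs fun u _ => by
      linarith [(abs_le.1 (hu u)).2]
    have e2 : f (Function.update S i z) ≤ f S + 1 := sup'_le_sup'_add hs fun u _ => by
      linarith [(abs_le.1 (hu u)).1]
    exact abs_le.2 ⟨by linarith, by linarith⟩
  have hmean : ∫ S, f S ∂P ≤ R * (C * F * √n) := by
    have := integral_sup'_deviation_le D s hs hR hsR a ham hF haF h hm h0 h1 hC hb n 0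
    simp only [inner_zero_left, zero_add, norm_zero] at this
    refine this.trans (le_of_eq ?_)
    rw [show (0:ℝ) ^ 2 + n * (C ^ 2 * F ^ 2) = (C * F) ^ 2 * n by ring,
      Real.sqrt_mul (by positivity), Real.sqrt_sq (by positivity)]
  have hn' : (0:ℝ) < n := by exact_mod_cast hn
  -- The exponent `4 t / n` minimises the Chernoff bound.
  have hmgf := integral_exp_le_of_bounded_differences D (4 * t / n) f hfm hfM hfd
  have hch := ProbabilityTheory.measure_ge_le_exp_mul_mgf (μ := P) (X := f)
    (R * (C * F * √n) + t) (t := 4 * t / n) (by positivity) (by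
      refine integrable_of_abs_le (by fun_prop) (M := Real.exp (4 * t / n * n)) fun S => ?_
      rw [abs_of_pos (Real.exp_pos _)]
      refine Real.exp_le_exp.2 ?_
      gcongr
      exact (abs_le.1 (hfM S)).2)
  have hfin : P.real {S | R * (C * F * √n) + t ≤ f S} ≤ Real.exp (-2 * t ^ 2 / n) := by
    refine hch.trans ((mul_le_mul_of_nonneg_left hmgf (Real.exp_pos _).le).trans ?_)
    rw [← Real.exp_add]
    refine Real.exp_le_exp.2 ?_
    have e : (n:ℝ) * (1 ^ 2 * (4 * t / n) ^ 2 / 8) = 2 * t ^ 2 / n := by field_simp; ring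
    have e' : (4 * t / n) * t = 4 * t ^ 2 / n := by ring
    have e'' : -2 * t ^ 2 / n = -(4 * t ^ 2 / n) + 2 * t ^ 2 / n := by ring
    rw [e, e'', ← e']
    have := mul_le_mul_of_nonneg_left hmean (show 0 ≤ 4 * t / n by positivity)
    nlinarith
  have h3 := ENNReal.ofReal_le_ofReal hfin
  rw [ofReal_measureReal] at h3
  refine (measure_mono ?_).trans h3
  intro S hS
  rw [Set.mem_ofPred_eq] at hS ⊢
  exact hS.le

/-- Uniform deviation over a ball of linear predictors, at a fixed radius `R`. -/
theorem measure_exists_deviation_gt_le (D : Measure Z) [IsProbabilityMeasure D] {R : ℝ}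
    (hR : 0 ≤ R) (a : Fin K → Z → H) (ham : ∀ l, Measurable (a l)) {F : ℝ} (hF : 0 ≤ F)
    (haF : ∀ z, ∑ l, ‖a l z‖ ^ 2 ≤ F ^ 2)
    (h : H → Z → ℝ) (hm : ∀ u, Measurable (h u)) (h0 : ∀ u z, 0 ≤ h u z) (h1 : ∀ u z, h u z ≤ 1)
    {C : ℝ} (hC : 0 ≤ C)
    (hb : ∀ u v z, 2 * √3 * |h u z - h v z| ≤ C * √(∑ l, (⟪a l z, u⟫ - ⟪a l z, v⟫) ^ 2))
    {n : ℕ} (hn : 0 < n) {t : ℝ} (ht : 0 ≤ t) :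
    (Measure.pi fun _ : Fin n => D) {S | ∃ u, ‖u‖ ≤ R ∧ R * (C * F * √n) + t
        < ∑ i, ((∫ z, h u z ∂D) - h u (S i))}
      ≤ ENNReal.ofReal (Real.exp (-2 * t ^ 2 / n)) := by
  have hint : ∀ u, Integrable (h u) D := fun u =>
    integrable_of_abs_le (hm u) (M := 1) fun z => abs_le.2 ⟨by linarith [h0 u z], h1 u z⟩
  have hlip : ∀ u v z, |h u z - h v z| ≤ C * F * ‖u - v‖ := by
    intro u v z
    have e : √(∑ l, (⟪a l z, u⟫ - ⟪a l z, v⟫) ^ 2) ≤ F * ‖u - v‖ := by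
      refine Real.sqrt_le_iff.2 ⟨by positivity, ?_⟩
      rw [mul_pow]
      refine le_trans ?_ (mul_le_mul_of_nonneg_right (haF z) (sq_nonneg _))
      rw [Finset.sum_mul]
      refine Finset.sum_le_sum fun l _ => ?_
      rw [← inner_sub_right, ← mul_pow, ← sq_abs]
      gcongr
      exact abs_real_inner_le_norm _ _
    have h3 : (1:ℝ) ≤ 2 * √3 := by
      have : (1:ℝ) ≤ √3 := Real.one_le_sqrt.2 (by norm_num)
      linarith
    have h4 : 1 * |h u z - h v z| ≤ 2 * √3 * |h u z - h v z| := by gcongr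
    have h5 := mul_le_mul_of_nonneg_left e hC
    linarith [hb u v z]
  have hcont : ∀ z, Continuous fun u => h u z := fun z => by
    refine (LipschitzWith.of_dist_le_mul (K := (C * F).toNNReal) fun u v => ?_).continuous
    rw [Real.dist_eq, dist_eq_norm, Real.coe_toNNReal _ (by positivity)]
    exact hlip u v z
  have hcontI : Continuous fun u => ∫ z, h u z ∂D := by
    refine (LipschitzWith.of_dist_le_mul (K := (C * F).toNNReal) fun u v => ?_).continuous
    rw [Real.dist_eq, dist_eq_norm, Real.coe_toNNReal _ (by positivity),
      ← integral_sub (hint u) (hint v)]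
    have := norm_integral_le_of_norm_le_const (μ := D) (f := fun z => h u z - h v z)
      (C := C * F * ‖u - v‖) (Filter.Eventually.of_forall fun z => hlip u v z)
    simpa using this
  -- A countable dense set of the ball suffices, and it is exhausted by finite sets.
  let B := Metric.closedBall (0:H) R
  have : Nonempty B := ⟨⟨0, by simpa [B] using hR⟩⟩
  let e : ℕ → B := TopologicalSpace.denseSeq B
  classical
  let s : ℕ → Finset H := fun N => (Finset.range (N + 1)).image fun m => (e m : H)
  have hs : ∀ N, (s N).Nonempty := fun N => (Finset.nonempty_range_add_one).image _
  have hsR : ∀ N, ∀ u ∈ s N, ‖u‖ ≤ R := by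
    intro N u hu
    obtain ⟨m, -, rfl⟩ := Finset.mem_image.1 hu
    exact mem_closedBall_zero_iff.1 (e m).2
  let A : ℕ → Set (Fin n → Z) := fun N => {S | R * (C * F * √n) + t
        < (s N).sup' (hs N) fun u => ∑ i, ((∫ z, h u z ∂D) - h u (S i))}
  have hA : Monotone A := by
    intro N M hNM S hS
    simp only [A, Set.mem_ofPred_eq] at hS ⊢
    refine lt_of_lt_of_le hS (Finset.sup'_mono _ ?_ _)
    exact Finset.image_subset_image (Finset.range_mono (by omega))
  have hsub : {S : Fin n → Z | ∃ u, ‖u‖ ≤ R ∧ R * (C * F * √n) + t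
        < ∑ i, ((∫ z, h u z ∂D) - h u (S i))} ⊆ ⋃ N, A N := by
    rintro S ⟨u, hu, hlt⟩
    have hopen : IsOpen {v : B | R * (C * F * √n) + t
        < ∑ i, ((∫ z, h v z ∂D) - h v (S i))} := by
      refine isOpen_lt continuous_const (continuous_finsetSum _ fun i _ => ?_)
      exact (hcontI.comp continuous_subtype_val).sub ((hcont _).comp continuous_subtype_val)
    obtain ⟨N, hN⟩ := (TopologicalSpace.denseRange_denseSeq B).exists_mem_open hopen
      ⟨⟨u, by simpa [B] using hu⟩, hlt⟩
    refine Set.mem_iUnion.2 ⟨N, ?_⟩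
    simp only [A, Set.mem_ofPred_eq] at hN ⊢
    have hmem : (e N : H) ∈ s N := Finset.mem_image.2 ⟨N, Finset.self_mem_range_succ N, rfl⟩
    exact lt_of_lt_of_le hN <| Finset.le_sup' (fun u => ∑ i, ((∫ z, h u z ∂D) - h u (S i))) hmem
  refine (measure_mono hsub).trans ?_
  rw [hA.measure_iUnion]
  exact iSup_le fun N => measure_sup'_deviation_gt_le D (s N) (hs N) hR (hsR N) a ham hF haF h hm
    h0 h1 hC hb hn ht

/-- Uniform deviation over all linear predictors, by a weighted union bound: the radius is
rounded up to a multiple `j / (2 F)`, and radius `j` is given failure probability `δ / 2 ^ j`. -/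
theorem measure_exists_deviation_gt_norm_le (D : Measure Z) [IsProbabilityMeasure D]
    (a : Fin K → Z → H) (ham : ∀ l, Measurable (a l)) {F : ℝ} (hF : 0 < F)
    (haF : ∀ z, ∑ l, ‖a l z‖ ^ 2 ≤ F ^ 2)
    (h : H → Z → ℝ) (hm : ∀ u, Measurable (h u)) (h0 : ∀ u z, 0 ≤ h u z) (h1 : ∀ u z, h u z ≤ 1)
    {C : ℝ} (hC : 0 ≤ C) (hC5 : C ≤ 5)
    (hb : ∀ u v z, 2 * √3 * |h u z - h v z| ≤ C * √(∑ l, (⟪a l z, u⟫ - ⟪a l z, v⟫) ^ 2))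
    {n : ℕ} (hn : 0 < n) {δ : ℝ} (hδ : 0 < δ) (hδ1 : δ < 1) :
    (Measure.pi fun _ : Fin n => D) {S | ∃ u, √n * (6 * (F * ‖u‖) + 5 * √(Real.log (2 / δ)))
        < ∑ i, ((∫ z, h u z ∂D) - h u (S i))} ≤ ENNReal.ofReal δ := by
  have hn' : (0:ℝ) < n := by exact_mod_cast hn
  have hlog2 : 0 < Real.log 2 := Real.log_pos (by norm_num)
  have hlog2' := Real.log_two_gt_d9
  have hlog2'' := Real.log_two_lt_d9
  have hlogδ : Real.log (2 / δ) = Real.log 2 - Real.log δ := Real.log_div (by norm_num) hδ.ne'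
  have hlogδ0 : Real.log δ < 0 := Real.log_neg hδ hδ1
  set Λ := Real.log (2 / δ) with hΛ
  have hΛpos : Real.log 2 < Λ := by linarith
  have hΛ0 : 0 < Λ := hlog2.trans hΛpos
  set t : ℕ → ℝ := fun j => √(n * ((Λ + j * Real.log 2) / 2)) with ht
  set A : ℕ → Set (Fin n → Z) := fun j => {S | ∃ u, ‖u‖ ≤ (j + 1) / (2 * F) ∧
    (j + 1) / (2 * F) * (C * F * √n) + t j < ∑ i, ((∫ z, h u z ∂D) - h u (S i))} with hA
  have hAδ : ∀ j, (Measure.pi fun _ : Fin n => D) (A j) ≤ ENNReal.ofReal (δ / 2 / 2 ^ j) := by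
    intro j
    refine (measure_exists_deviation_gt_le D (by positivity) a ham hF.le haF h hm h0 h1 hC hb hn
      (Real.sqrt_nonneg _)).trans (le_of_eq ?_)
    congr 1
    rw [Real.sq_sqrt (by positivity)]
    have e : -2 * (n * ((Λ + j * Real.log 2) / 2)) / n
        = Real.log δ - Real.log 2 - j * Real.log 2 := by
      rw [hlogδ]; field_simp; ring
    rw [e, Real.exp_sub, Real.exp_sub, Real.exp_log hδ, Real.exp_log two_pos, mul_comm,
      Real.exp_mul, Real.exp_log two_pos, Real.rpow_natCast]
  have hsub : {S : Fin n → Z | ∃ u, √n * (6 * (F * ‖u‖) + 5 * √Λ)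
        < ∑ i, ((∫ z, h u z ∂D) - h u (S i))} ⊆ ⋃ j, A j := by
    rintro S ⟨u, hu⟩
    set ρ := F * ‖u‖ with hρ
    have hρ0 : 0 ≤ ρ := by positivity
    set j := ⌊2 * ρ⌋₊ with hj
    have hj1 : (j:ℝ) ≤ 2 * ρ := Nat.floor_le (by positivity)
    have hj2 : 2 * ρ < j + 1 := Nat.lt_floor_add_one _
    refine Set.mem_iUnion.2 ⟨j, u, ?_, lt_of_le_of_lt ?_ hu⟩
    · rw [le_div_iff₀ (by positivity)]
      linarith
    have e1 : (j + 1) / (2 * F) * (C * F * √n) ≤ √n * (5 * ρ + 5 / 2) := by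
      have : (j + 1) / (2 * F) * (C * F * √n) = √n * (C * ((j + 1) / 2)) := by field_simp
      rw [this]
      have h2 : C * (((j:ℝ) + 1) / 2) ≤ 5 * ((2 * ρ + 1) / 2) := by gcongr
      have h3 : C * (((j:ℝ) + 1) / 2) ≤ 5 * ρ + 5 / 2 := by linarith
      gcongr
    have e2 : t j ≤ √n * (3 / 4 * √Λ + (ρ + 1 / 5)) := by
      rw [ht]
      simp only
      rw [Real.sqrt_mul hn'.le]
      gcongr
      refine Real.sqrt_le_iff.2 ⟨by positivity, ?_⟩
      have hs : √Λ ^ 2 = Λ := Real.sq_sqrt (by linarith)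
      have hj3 : j * Real.log 2 ≤ 2 * ρ * (7 / 10) := by gcongr; linarith
      nlinarith [Real.sqrt_nonneg Λ, sq_nonneg (ρ - 1 / 5), mul_nonneg (Real.sqrt_nonneg Λ) hρ0]
    have e3 : (4 / 5 : ℝ) ≤ √Λ := Real.le_sqrt_of_sq_le (by linarith)
    have e4 : √n * (5 * ρ + 5 / 2) + √n * (3 / 4 * √Λ + (ρ + 1 / 5))
        ≤ √n * (6 * ρ + 5 * √Λ) := by
      rw [← mul_add]
      exact mul_le_mul_of_nonneg_left (by linarith) (Real.sqrt_nonneg _)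
    linarith
  refine (measure_mono hsub).trans ((measure_iUnion_le _).trans ?_)
  refine (ENNReal.tsum_le_tsum hAδ).trans (le_of_eq ?_)
  rw [← ENNReal.ofReal_tsum_of_nonneg (fun j => by positivity) (hasSum_geometric_two' δ).summable,
    tsum_geometric_two']

end Deviation

/-! ### Gradient descent near its linearisation -/

section Descent

open ContinuousLinearMap Finset
open scoped RealInnerProductSpace

theorem norm_image_sub_sub_le_of_mem_ball {E F : Type*} [NormedAddCommGroup E]
    [NormedSpace ℝ E] [NormedAddCommGroup F] [NormedSpace ℝ F] {f : E → F} (hf : Differentiable ℝ f) {w₀ : E} {L R : ℝ}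
    (hL0 : 0 ≤ L) (hL : ∀ w, ‖fderiv ℝ f w - fderiv ℝ f w₀‖ ≤ L * ‖w - w₀‖)
    {w w' : E} (hw : ‖w - w₀‖ ≤ R) (hw' : ‖w' - w₀‖ ≤ R) :
    ‖f w' - f w - fderiv ℝ f w₀ (w' - w)‖ ≤ L * R * ‖w' - w‖ := by
  refine Convex.norm_image_sub_le_of_norm_fderiv_le' (𝕜 := ℝ) (fun x _ => hf x) (fun x hx => ?_)
    (convex_closedBall w₀ R) (mem_closedBall_iff_norm.2 hw) (mem_closedBall_iff_norm.2 hw')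
  refine (hL x).trans ?_
  gcongr
  exact mem_closedBall_iff_norm.1 hx

variable {E F : Type*} [NormedAddCommGroup E] [InnerProductSpace ℝ E] [CompleteSpace E]
  [NormedAddCommGroup F] [InnerProductSpace ℝ F] [CompleteSpace F]

/-- The residual of linearised gradient descent, `q_{t+1} = (1 - η A A*) q_t`. -/
def linearIter (A : E →L[ℝ] F) (η : ℝ) (q₀ : F) (t : ℕ) : F :=
  (fun q => q - η • A (adjoint A q))^[t] q₀

theorem linearIter_succ (A : E →L[ℝ] F) (η : ℝ) (q₀ : F) (t : ℕ) :
    linearIter A η q₀ (t + 1)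
      = linearIter A η q₀ t - η • A (adjoint A (linearIter A η q₀ t)) := by
  simp [linearIter, Function.iterate_succ_apply']

theorem norm_sub_smul_sq_le (A : E →L[ℝ] F) {β η : ℝ} (hA : ‖A‖ ≤ β) (hη : 0 ≤ η)
    (hηβ : η * β ^ 2 ≤ 1) (q : F) :
    ‖q - η • A (adjoint A q)‖ ^ 2 ≤ ‖q‖ ^ 2 - η * ‖adjoint A q‖ ^ 2 := by
  have h1 : ⟪q, η • A (adjoint A q)⟫ = η * ‖adjoint A q‖ ^ 2 := by
    rw [real_inner_smul_right, ← adjoint_inner_left, real_inner_self_eq_norm_sq]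
  have h2 : ‖A (adjoint A q)‖ ≤ β * ‖adjoint A q‖ := A.le_of_opNorm_le hA _
  have h3 : ‖A (adjoint A q)‖ ^ 2 ≤ β ^ 2 * ‖adjoint A q‖ ^ 2 := by
    rw [← mul_pow]; gcongr
  rw [norm_sub_sq_real, h1, norm_smul, mul_pow, Real.norm_of_nonneg hη]
  have h4 : η ^ 2 * ‖A (adjoint A q)‖ ^ 2 ≤ η * (η * β ^ 2) * ‖adjoint A q‖ ^ 2 := by
    nlinarith [mul_le_mul_of_nonneg_left h3 (sq_nonneg η)]
  have h5 : η * (η * β ^ 2) * ‖adjoint A q‖ ^ 2 ≤ η * 1 * ‖adjoint A q‖ ^ 2 := by gcongr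
  linarith

/-- Energy estimate for a perturbed linear iteration whose perturbations are dominated by the
increments of `M`. The bound on `∑ A* q_s` gains `√(η t)` over the trivial bound `η t ‖A‖`. -/
theorem norm_le_and_norm_sum_adjoint_le (A : E →L[ℝ] F) {β η : ℝ} (hA : ‖A‖ ≤ β) (hη : 0 ≤ η)
    (hηβ : η * β ^ 2 ≤ 1) (q : ℕ → F) (M : ℕ → ℝ) (hM : ∀ t, 0 ≤ M t) (h0 : ‖q 0‖ ≤ M 0) (T : ℕ)
    (hstep : ∀ t < T, ‖q t‖ ≤ M t →
      ‖q (t + 1) - (q t - η • A (adjoint A (q t)))‖ ≤ M (t + 1) - M t) (t : ℕ) (ht : t ≤ T) :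
    ‖q t‖ ≤ M t ∧ ‖η • ∑ s ∈ range (t + 1), adjoint A (q s)‖ ≤ √(η * (t + 1)) * M t := by
  have main : ∀ t ≤ T, ‖q t‖ ^ 2 + η * ∑ s ∈ range t, ‖adjoint A (q s)‖ ^ 2 ≤ M t ^ 2 := by
    intro t
    induction t with
    | zero => intro _; simpa using pow_le_pow_left₀ (norm_nonneg _) h0 2
    | succ t ih =>
      intro ht
      have iht := ih (by omega)
      have hS : 0 ≤ η * ∑ s ∈ range t, ‖adjoint A (q s)‖ ^ 2 := by positivity
      have hq : ‖q t‖ ≤ M t := abs_le_of_sq_le_sq' (by linarith) (hM t) |>.2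
      have hs := hstep t (by omega) hq
      have hc := norm_sub_smul_sq_le A hA hη hηβ (q t)
      set p := q t - η • A (adjoint A (q t)) with hp
      have hpM : ‖p‖ ≤ M t := by
        refine abs_le_of_sq_le_sq' ?_ (hM t) |>.2
        have : 0 ≤ η * ‖adjoint A (q t)‖ ^ 2 := by positivity
        linarith
      have htri : ‖q (t + 1)‖ ≤ ‖p‖ + (M (t + 1) - M t) := by
        calc ‖q (t + 1)‖ = ‖p + (q (t + 1) - p)‖ := by congr 1; abel
          _ ≤ _ := (norm_add_le _ _).trans (by gcongr)
      have hinc : 0 ≤ M (t + 1) - M t := (norm_nonneg _).trans hs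
      have hsq : ‖q (t + 1)‖ ^ 2 ≤ (‖p‖ + (M (t + 1) - M t)) ^ 2 := by gcongr
      rw [sum_range_succ, mul_add]
      nlinarith [mul_le_mul_of_nonneg_right hpM hinc]
  have hmt := main t ht
  have hS : 0 ≤ η * ∑ s ∈ range t, ‖adjoint A (q s)‖ ^ 2 := by positivity
  refine ⟨abs_le_of_sq_le_sq' (by linarith) (hM t) |>.2, ?_⟩
  have hc := norm_sub_smul_sq_le A hA hη hηβ (q t)
  have hE : η * ∑ s ∈ range (t + 1), ‖adjoint A (q s)‖ ^ 2 ≤ M t ^ 2 := by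
    rw [sum_range_succ, mul_add]
    linarith [sq_nonneg ‖q t - η • A (adjoint A (q t))‖]
  have hCS := sq_sum_le_card_mul_sum_sq (s := range (t + 1)) (f := fun s => ‖adjoint A (q s)‖)
  rw [card_range] at hCS
  push_cast at hCS
  refine abs_le_of_sq_le_sq' ?_ (by have := hM t; positivity) |>.2
  rw [mul_pow, Real.sq_sqrt (by positivity), norm_smul, mul_pow, Real.norm_of_nonneg hη]
  have hn : ‖∑ s ∈ range (t + 1), adjoint A (q s)‖ ^ 2
      ≤ (∑ s ∈ range (t + 1), ‖adjoint A (q s)‖) ^ 2 := by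
    gcongr; exact norm_sum_le _ _
  calc η ^ 2 * ‖∑ s ∈ range (t + 1), adjoint A (q s)‖ ^ 2
      ≤ η ^ 2 * ((t + 1) * ∑ s ∈ range (t + 1), ‖adjoint A (q s)‖ ^ 2) := by
        gcongr; exact hn.trans hCS
    _ = η * (t + 1) * (η * ∑ s ∈ range (t + 1), ‖adjoint A (q s)‖ ^ 2) := by ring
    _ ≤ η * (t + 1) * M t ^ 2 := by gcongr

/-- Gradient descent on `½ ‖f w - y‖²` for time `θ = η T` stays in the ball of radius `R` on which
the derivative of `f` moves by at most `L R`, and there it follows linearised gradient descent. -/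
theorem gradientDescent_near_linear {f : E → F} (hf : Differentiable ℝ f) (y : F) {β L R η θ : ℝ}
    (hβ0 : 0 ≤ β) (hβ : ∀ w, ‖fderiv ℝ f w‖ ≤ β) (hL0 : 0 ≤ L) (hR : 0 ≤ R) (hη : 0 ≤ η)
    (hηβ : η * β ^ 2 ≤ 1) (W : ℕ → E)
    (hL : ∀ w, ‖fderiv ℝ f w - fderiv ℝ f (W 0)‖ ≤ L * ‖w - W 0‖)
    (hW : ∀ t, W (t + 1) = W t - η • adjoint (fderiv ℝ f (W t)) (f (W t) - y))
    (T : ℕ) (hT : η * T = θ) {x : ℝ} (hx : x = 2 * θ * β * (L * R))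
    (hball : Real.exp x * ‖f (W 0) - y‖ * (√θ + θ * (L * R)) ≤ R) :
    ‖W T - W 0‖ ≤ R ∧
    ‖f (W T) - y - linearIter (fderiv ℝ f (W 0)) η (f (W 0) - y) T‖
      ≤ (Real.exp x - 1) * ‖f (W 0) - y‖ ∧
    ‖W T - W 0 + η • ∑ s ∈ range T, adjoint (fderiv ℝ f (W 0))
        (linearIter (fderiv ℝ f (W 0)) η (f (W 0) - y) s)‖
      ≤ (√θ * (Real.exp x - 1) + θ * (L * R) * Real.exp x) * ‖f (W 0) - y‖ := by
  set A := fderiv ℝ f (W 0) with hA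
  set r : ℕ → F := fun t => f (W t) - y with hr
  set ε := L * R with hε
  have hε0 : 0 ≤ ε := by positivity
  set κ := 2 * η * β * ε with hκ
  have hκ0 : 0 ≤ κ := by positivity
  set M : ℕ → ℝ := fun t => (1 + κ) ^ t * ‖r 0‖ with hM
  have hM0 : ∀ t, 0 ≤ M t := fun t => by positivity
  have hMmono : Monotone M := fun s t hst => by
    simp only [hM]; gcongr; linarith
  have hMT : M T ≤ Real.exp x * ‖r 0‖ := by
    simp only [hM]
    gcongr
    have h1 : (1 + κ) ^ T ≤ Real.exp κ ^ T := by gcongr; linarith [Real.add_one_le_exp κ]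
    rw [← Real.exp_nat_mul] at h1
    refine h1.trans (le_of_eq ?_)
    rw [hx, hκ, ← hT]; ring_nf
  have hMsucc : ∀ t, M (t + 1) - M t = κ * M t := fun t => by simp only [hM, pow_succ]; ring
  have hadj : ∀ t, ‖W t - W 0‖ ≤ R → ‖adjoint (fderiv ℝ f (W t) - A) (r t)‖ ≤ ε * ‖r t‖ := by
    intro t ht
    refine (le_opNorm _ _).trans ?_
    rw [LinearIsometryEquiv.norm_map]
    gcongr
    exact (hL _).trans (by rw [hε]; gcongr)
  have hsplit : ∀ t, adjoint (fderiv ℝ f (W t)) (r t)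
      = adjoint A (r t) + adjoint (fderiv ℝ f (W t) - A) (r t) := by
    intro t; rw [map_sub adjoint, sub_apply, add_sub_cancel]
  -- One step of the residual, as a perturbed linear iteration.
  have hstep : ∀ t, ‖W t - W 0‖ ≤ R → ‖W (t + 1) - W 0‖ ≤ R →
      ‖r (t + 1) - (r t - η • A (adjoint A (r t)))‖ ≤ κ * ‖r t‖ := by
    intro t h1 h2
    have hlin := norm_image_sub_sub_le_of_mem_ball hf hL0 hL h1 h2
    have hd : W (t + 1) - W t = -(η • adjoint (fderiv ℝ f (W t)) (r t)) := by
      rw [hW]; simp [hr]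
    have hnd : ‖W (t + 1) - W t‖ ≤ η * (β * ‖r t‖) := by
      rw [hd, norm_neg, norm_smul, Real.norm_of_nonneg hη]
      gcongr
      refine (le_opNorm _ _).trans ?_
      rw [LinearIsometryEquiv.norm_map]
      gcongr
      exact hβ _
    have e : r (t + 1) - (r t - η • A (adjoint A (r t)))
        = (f (W (t + 1)) - f (W t) - A (W (t + 1) - W t))
          - η • A (adjoint (fderiv ℝ f (W t) - A) (r t)) := by
      rw [hd, hsplit, map_neg, map_smul, map_add, smul_add]
      simp only [hr]
      abel
    rw [e]
    refine (norm_sub_le _ _).trans ?_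
    have h3 : ‖η • A (adjoint (fderiv ℝ f (W t) - A) (r t))‖ ≤ η * (β * (ε * ‖r t‖)) := by
      rw [norm_smul, Real.norm_of_nonneg hη]
      gcongr
      exact (A.le_of_opNorm_le (hβ _) _).trans (by gcongr; exact hadj t h1)
    have h4 : L * R * ‖W (t + 1) - W t‖ ≤ ε * (η * (β * ‖r t‖)) := by gcongr
    rw [hκ]
    linarith
  have hsum : ∀ t, W t - W 0 = -(η • ∑ s ∈ range t, adjoint A (r s))
      - η • ∑ s ∈ range t, adjoint (fderiv ℝ f (W s) - A) (r s) := by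
    intro t
    induction t with
    | zero => simp
    | succ t ih =>
      have : W (t + 1) - W 0 = (W t - W 0) - η • adjoint (fderiv ℝ f (W t)) (r t) := by
        rw [hW]; simp only [hr]; abel
      rw [this, ih, hsplit, sum_range_succ, sum_range_succ, smul_add, smul_add, smul_add]
      abel
  have hdrift : ∀ t ≤ T, (∀ s < t, ‖W s - W 0‖ ≤ R) → (∀ s < t, ‖r s‖ ≤ M s) →
      ‖η • ∑ s ∈ range t, adjoint (fderiv ℝ f (W s) - A) (r s)‖ ≤ θ * ε * (Real.exp x * ‖r 0‖) := by
    intro t ht h1 h2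
    rw [norm_smul, Real.norm_of_nonneg hη]
    have h3 : ‖∑ s ∈ range t, adjoint (fderiv ℝ f (W s) - A) (r s)‖
        ≤ ∑ _s ∈ range t, ε * (Real.exp x * ‖r 0‖) := by
      refine norm_sum_le_of_le _ fun s hs => ?_
      have hs' := mem_range.1 hs
      refine (hadj s (h1 s hs')).trans ?_
      gcongr
      exact (h2 s hs').trans ((hMmono (by omega)).trans hMT)
    rw [sum_const, card_range, nsmul_eq_mul] at h3
    have h4 : (t:ℝ) * (ε * (Real.exp x * ‖r 0‖)) ≤ T * (ε * (Real.exp x * ‖r 0‖)) := by gcongr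
    have h5 := mul_le_mul_of_nonneg_left (h3.trans h4) hη
    rw [← hT]
    linarith
  have henergy : ∀ t, (∀ s ≤ t, ‖W s - W 0‖ ≤ R) → ∀ s ≤ t, ‖r s‖ ≤ M s ∧
      ‖η • ∑ i ∈ range (s + 1), adjoint A (r i)‖ ≤ √(η * (s + 1)) * M s := by
    intro t ht s hs
    refine norm_le_and_norm_sum_adjoint_le A (hβ _) hη hηβ r M hM0 (by simp [hM]) t ?_ s hs
    intro i hi hri
    rw [hMsucc]
    exact (hstep i (ht i hi.le) (ht (i + 1) hi)).trans (by gcongr)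
  have htime : ∀ t : ℕ, t + 1 ≤ T → η * (t + 1) ≤ θ := by
    intro t ht
    rw [← hT]
    gcongr
    exact_mod_cast ht
  have hin : ∀ t ≤ T, ‖W t - W 0‖ ≤ R := by
    intro t
    induction t using Nat.strong_induction_on with
    | _ t ih =>
      intro ht
      rcases t with _ | t
      · simpa using hR
      have hprev : ∀ s ≤ t, ‖W s - W 0‖ ≤ R := fun s hs => ih s (by omega) (by omega)
      have he := henergy t hprev
      rw [hsum]
      have hd := hdrift (t + 1) ht (fun s hs => hprev s (by omega)) fun s hs => (he s (by omega)).1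
      have h1 : √(η * (t + 1)) * M t ≤ √θ * (Real.exp x * ‖r 0‖) := by
        have := hM0 t
        gcongr
        · exact htime t ht
        · exact (hMmono (by omega)).trans hMT
      refine (norm_sub_le _ _).trans ?_
      rw [norm_neg]
      have h2 := (he t le_rfl).2
      refine le_trans ?_ hball
      have : f (W 0) - y = r 0 := rfl
      rw [this]
      linarith
  have hrM : ∀ s ≤ T, ‖r s‖ ≤ M s := fun s hs => (henergy T hin s hs).1
  set q := linearIter A η (r 0) with hq
  have hp : ∀ t ≤ T, ‖r t - q t‖ ≤ M t - ‖r 0‖ ∧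
      ‖η • ∑ s ∈ range (t + 1), adjoint A (r s - q s)‖ ≤ √(η * (t + 1)) * (M t - ‖r 0‖) := by
    have hM00 : M 0 = ‖r 0‖ := by simp [hM]
    refine norm_le_and_norm_sum_adjoint_le A (hβ _) hη hηβ (fun t => r t - q t)
      (fun t => M t - ‖r 0‖) (fun t => ?_) ?_ T ?_
    · rw [← hM00]; exact sub_nonneg.2 (hMmono (Nat.zero_le t))
    · simp [hM00, hq, linearIter]
    · intro t ht _
      have e : r (t + 1) - q (t + 1) - (r t - q t - η • A (adjoint A (r t - q t)))
          = r (t + 1) - (r t - η • A (adjoint A (r t))) := by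
        rw [hq, linearIter_succ, map_sub, map_sub, smul_sub]
        abel
      rw [e, show M (t + 1) - ‖r 0‖ - (M t - ‖r 0‖) = κ * M t by rw [← hMsucc]; ring]
      exact (hstep t (hin t ht.le) (hin (t + 1) ht)).trans (by gcongr; exact hrM t ht.le)
  have hMT' : M T - ‖r 0‖ ≤ (Real.exp x - 1) * ‖r 0‖ := by linarith
  refine ⟨hin T le_rfl, (hp T le_rfl).1.trans hMT', ?_⟩
  have hdr := hdrift T le_rfl (fun s hs => hin s hs.le) fun s hs => hrM s hs.le
  have e : W T - W 0 + η • ∑ s ∈ range T, adjoint A (q s)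
      = -(η • ∑ s ∈ range T, adjoint A (r s - q s))
        - η • ∑ s ∈ range T, adjoint (fderiv ℝ f (W s) - A) (r s) := by
    rw [hsum T]
    simp only [map_sub, sum_sub_distrib, smul_sub]
    abel
  have hpT : ‖η • ∑ s ∈ range T, adjoint A (r s - q s)‖ ≤ √θ * ((Real.exp x - 1) * ‖r 0‖) := by
    rcases T with _ | t
    · simp only [range_zero, sum_empty, smul_zero, norm_zero]
      have h0 := (hp 0 le_rfl).1
      have := (norm_nonneg _).trans h0
      have := this.trans hMT'
      positivity
    · refine (hp t (by omega)).2.trans ?_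
      have h0 := (norm_nonneg _).trans (hp t (by omega)).1
      gcongr
      · exact htime t le_rfl
      · refine le_trans ?_ hMT'
        gcongr
        exact hMmono (by omega)
  change ‖W T - W 0 + η • ∑ s ∈ range T, adjoint A (q s)‖ ≤ _
  rw [e]
  refine (norm_sub_le _ _).trans ?_
  rw [norm_neg]
  have : f (W 0) - y = r 0 := rfl
  rw [this]
  linarith

end Descent

/-! ### Singular vectors and linearised gradient descent -/

section Spectral

open ContinuousLinearMap Finset
open scoped RealInnerProductSpace

theorem adjoint_ofLp {m p : Type*} [Fintype m] [Fintype p] {J : Matrix m p ℝ} {A : EuclideanSpace ℝ p →L[ℝ] EuclideanSpace ℝ m}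
    (hA : ∀ w, (A w).ofLp = J *ᵥ w.ofLp) (q : EuclideanSpace ℝ m) :
    (adjoint A q).ofLp = Jᵀ *ᵥ q.ofLp := by
  have : adjoint A q = WithLp.toLp 2 (Jᵀ *ᵥ q.ofLp) := by
    refine ext_inner_right ℝ fun w => ?_
    rw [adjoint_inner_left, EuclideanSpace.inner_eq_star_dotProduct,
      EuclideanSpace.inner_eq_star_dotProduct, hA]
    simp only [star_trivial]
    rw [Matrix.mulVec_transpose, dotProduct_comm w.ofLp, ← Matrix.dotProduct_mulVec,
      dotProduct_comm]
  rw [this]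

variable {m p : Type*} [Fintype m] [DecidableEq m] [Fintype p]

theorem singularValue_sq (J : Matrix m p ℝ) (s : m) :
    singularValue J s ^ 2 = (Matrix.isHermitian_mul_conjTranspose_self J).eigenvalues s :=
  Real.sq_sqrt ((Matrix.posSemidef_self_mul_conjTranspose J).eigenvalues_nonneg s)

theorem singularValue_nonneg (J : Matrix m p ℝ) (s : m) : 0 ≤ singularValue J s :=
  Real.sqrt_nonneg _

theorem mulVec_transpose_mulVec_leftSingularVector (J : Matrix m p ℝ) (s : m) :
    J *ᵥ (Jᵀ *ᵥ (leftSingularVector J s).ofLp)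
      = singularValue J s ^ 2 • (leftSingularVector J s).ofLp := by
  rw [singularValue_sq, Matrix.mulVec_mulVec]
  exact (Matrix.isHermitian_mul_conjTranspose_self J).mulVec_eigenvectorBasis s

theorem dotProduct_leftSingularVector (J : Matrix m p ℝ) (s t : m) :
    (leftSingularVector J s).ofLp ⬝ᵥ (leftSingularVector J t).ofLp = if s = t then 1 else 0 := by
  have h := orthonormal_iff_ite.1
    (Matrix.isHermitian_mul_conjTranspose_self J).eigenvectorBasis.orthonormal t s
  rw [EuclideanSpace.inner_eq_star_dotProduct] at h
  simpa [leftSingularVector, eq_comm] using h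

theorem dotProduct_transpose_mulVec (J : Matrix m p ℝ) (s t : m) :
    (Jᵀ *ᵥ (leftSingularVector J s).ofLp) ⬝ᵥ (Jᵀ *ᵥ (leftSingularVector J t).ofLp)
      = if s = t then singularValue J t ^ 2 else 0 := by
  rw [Matrix.mulVec_transpose, ← Matrix.dotProduct_mulVec,
    mulVec_transpose_mulVec_leftSingularVector, dotProduct_smul, dotProduct_leftSingularVector]
  simp

theorem vecMul_truncated (J : Matrix m p ℝ) {α : ℝ} (hα : 0 < α) {s : m}
    (hs : α ≤ singularValue J s) :
    (leftSingularVector J s).ofLp ᵥ* truncated J α = Jᵀ *ᵥ (leftSingularVector J s).ofLp := by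
  classical
  have hpos := hα.trans_le hs
  unfold truncated
  rw [Matrix.vecMul_sum, Finset.sum_eq_single s]
  · simp [Matrix.vecMul_vecMulVec, dotProduct_leftSingularVector,
      rightSingularVector, smul_smul, hpos.ne']
  · intro t _ ht
    simp [Matrix.vecMul_smul, Matrix.vecMul_vecMulVec, dotProduct_leftSingularVector, ht.symm]
  · intro h
    simp [hs] at h

theorem truncated_mulVec (J : Matrix m p ℝ) {α : ℝ} (hα : 0 < α) {s : m}
    (hs : α ≤ singularValue J s) :
    truncated J α *ᵥ ((singularValue J s ^ 2)⁻¹ • (Jᵀ *ᵥ (leftSingularVector J s).ofLp))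
      = (leftSingularVector J s).ofLp := by
  classical
  have hpos := hα.trans_le hs
  unfold truncated
  rw [Matrix.sum_mulVec, Finset.sum_eq_single s]
  · ext i
    simp [Matrix.smul_mulVec, Matrix.mulVec_smul, Matrix.vecMulVec_mulVec, rightSingularVector,
      dotProduct_transpose_mulVec, -Matrix.mulVec_mulVec]
    field_simp
  · intro t _ ht
    simp [Matrix.smul_mulVec, Matrix.mulVec_smul, Matrix.vecMulVec_mulVec, rightSingularVector,
      dotProduct_transpose_mulVec, ht, -Matrix.mulVec_mulVec]
  · intro h
    simp [hs] at h

/-- On the information space, `A_I A_I†` acts as the identity, so the coefficients of `q` can be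
read off from `A_I† q`. -/
theorem dotProduct_pseudoInverse_mulVec [DecidableEq p] (J : Matrix m p ℝ) {α : ℝ} (hα : 0 < α) {s : m}
    (hs : α ≤ singularValue J s) (q : m → ℝ) :
    (Jᵀ *ᵥ (leftSingularVector J s).ofLp) ⬝ᵥ (pseudoInverse (truncated J α) *ᵥ q)
      = (leftSingularVector J s).ofLp ⬝ᵥ q := by
  have hP : IsPseudoInverse (truncated J α) (pseudoInverse (truncated J α)) :=
    (exists_isPseudoInverse _).choose_spec
  set A := truncated J α
  set P := pseudoInverse A
  have h1 : (A * P) *ᵥ (leftSingularVector J s).ofLp = (leftSingularVector J s).ofLp := by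
    conv_lhs => rw [← truncated_mulVec J hα hs]
    rw [Matrix.mulVec_mulVec, hP.mul_mul_self, truncated_mulVec J hα hs]
  rw [← vecMul_truncated J hα hs, ← Matrix.dotProduct_mulVec, Matrix.mulVec_mulVec,
    Matrix.dotProduct_mulVec, ← Matrix.mulVec_transpose, hP.symm_left, h1]

/-- `‖J_I† q‖²` dominates `∑ ⟪u_s, q⟫² / λ_s²` over the information space, by Bessel's inequality for
the right singular vectors. -/
theorem sum_info_sq_div_le [DecidableEq p] (J : Matrix m p ℝ) {α : ℝ} (hα : 0 < α) (q : EuclideanSpace ℝ m) :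
    ∑ s with ¬ singularValue J s < α,
        (⟪leftSingularVector J s, q⟫ / singularValue J s) ^ 2
      ≤ ‖WithLp.toLp 2 (pseudoInverse (truncated J α) *ᵥ q.ofLp)‖ ^ 2 := by
  set x : EuclideanSpace ℝ p := WithLp.toLp 2 (pseudoInverse (truncated J α) *ᵥ q.ofLp) with hx
  let v : {s // ¬ singularValue J s < α} → EuclideanSpace ℝ p :=
    fun s => WithLp.toLp 2 (rightSingularVector J s)
  have hpos : ∀ s : {s // ¬ singularValue J s < α}, 0 < singularValue J s := fun s =>
    hα.trans_le (not_lt.1 s.2)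
  have hv : Orthonormal ℝ v := by
    rw [orthonormal_iff_ite]
    intro s t
    rw [EuclideanSpace.inner_eq_star_dotProduct]
    have e := dotProduct_transpose_mulVec J t s
    simp only [v, rightSingularVector, star_trivial, smul_dotProduct, dotProduct_smul, e,
      smul_eq_mul]
    by_cases h : s = t
    · subst h
      have := (hpos s).ne'
      simp
      field_simp
    · have : ¬ (t : m) = s := fun h' => h (Subtype.ext h'.symm)
      simp [h, this]
  have hB := hv.sum_inner_products_le x (s := Finset.univ)
  refine le_trans (le_of_eq ?_) hB
  rw [← Finset.sum_subtype_eq_sum_filter, ← Finset.subtype_univ]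
  refine Finset.sum_congr rfl fun s _ => ?_
  rw [Real.norm_eq_abs, sq_abs]
  congr 1
  rw [EuclideanSpace.inner_eq_star_dotProduct, EuclideanSpace.inner_eq_star_dotProduct]
  simp only [v, rightSingularVector, star_trivial, dotProduct_smul, hx, smul_eq_mul]
  rw [dotProduct_comm, dotProduct_comm _ (Jᵀ *ᵥ _),
    dotProduct_pseudoInverse_mulVec J hα (not_lt.1 s.2)]
  field_simp

theorem sum_nuisance_sq_le (J : Matrix m p ℝ) (α : ℝ) (q : EuclideanSpace ℝ m) :
    ∑ s with singularValue J s < α, ⟪leftSingularVector J s, q⟫ ^ 2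
      ≤ ‖(nuisanceSpace J α).starProjection q‖ ^ 2 := by
  set N := nuisanceSpace J α
  have hB := (Matrix.isHermitian_mul_conjTranspose_self J).eigenvectorBasis.orthonormal
    |>.sum_inner_products_le (N.starProjection q) (s := {s | singularValue J s < α})
  refine le_trans (Finset.sum_le_sum fun s hs => le_of_eq ?_) hB
  have hmem : leftSingularVector J s ∈ N :=
    Submodule.subset_span ⟨s, (Finset.mem_filter.1 hs).2, rfl⟩
  rw [Real.norm_eq_abs, sq_abs]
  congr 1
  change _ = ⟪leftSingularVector J s, _⟫
  rw [← Submodule.inner_starProjection_left_eq_right,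
    Submodule.starProjection_eq_self_iff.2 hmem]

section Iterates

variable {J : Matrix m p ℝ} {A : EuclideanSpace ℝ p →L[ℝ] EuclideanSpace ℝ m}

theorem apply_adjoint_leftSingularVector (hA : ∀ w, (A w).ofLp = J *ᵥ w.ofLp) (s : m) :
    A (adjoint A (leftSingularVector J s)) = singularValue J s ^ 2 • leftSingularVector J s := by
  apply WithLp.ofLp_injective
  rw [hA, adjoint_ofLp hA, mulVec_transpose_mulVec_leftSingularVector]
  rfl

theorem inner_apply_adjoint (hA : ∀ w, (A w).ofLp = J *ᵥ w.ofLp) (s : m)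
    (q : EuclideanSpace ℝ m) :
    ⟪leftSingularVector J s, A (adjoint A q)⟫
      = singularValue J s ^ 2 * ⟪leftSingularVector J s, q⟫ := by
  rw [← adjoint_inner_left, ← adjoint_inner_left (A := adjoint A), adjoint_adjoint,
    apply_adjoint_leftSingularVector hA, real_inner_smul_left]

theorem singularValue_le (hA : ∀ w, (A w).ofLp = J *ᵥ w.ofLp) (s : m) :
    singularValue J s ≤ ‖A‖ := by
  have h1 : ‖leftSingularVector J s‖ = 1 :=
    (Matrix.isHermitian_mul_conjTranspose_self J).eigenvectorBasis.orthonormal.1 s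
  have h2 : singularValue J s ^ 2 = ‖adjoint A (leftSingularVector J s)‖ ^ 2 := by
    rw [← real_inner_self_eq_norm_sq, adjoint_inner_left, inner_apply_adjoint hA,
      real_inner_self_eq_norm_sq, h1]
    ring
  have h3 : ‖adjoint A (leftSingularVector J s)‖ ≤ ‖A‖ := by
    have := (adjoint A).le_opNorm (leftSingularVector J s)
    rwa [h1, mul_one, LinearIsometryEquiv.norm_map] at this
  exact ((sq_eq_sq₀ (singularValue_nonneg J s) (norm_nonneg _)).1 h2).trans_le h3

theorem inner_linearIter (hA : ∀ w, (A w).ofLp = J *ᵥ w.ofLp) (η : ℝ) (q : EuclideanSpace ℝ m)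
    (s : m) (t : ℕ) :
    ⟪leftSingularVector J s, linearIter A η q t⟫
      = (1 - η * singularValue J s ^ 2) ^ t * ⟪leftSingularVector J s, q⟫ := by
  induction t with
  | zero => simp [linearIter]
  | succ t ih =>
    rw [linearIter_succ, inner_sub_right, real_inner_smul_right, inner_apply_adjoint hA, ih]
    ring

theorem norm_sq_eq_sum_inner_sq (J : Matrix m p ℝ) (q : EuclideanSpace ℝ m) :
    ‖q‖ ^ 2 = ∑ s, ⟪leftSingularVector J s, q⟫ ^ 2 := by
  rw [← (Matrix.isHermitian_mul_conjTranspose_self J).eigenvectorBasis.sum_sq_norm_inner_right q]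
  simp [leftSingularVector]

/-- After time `Γ / α²` the linearised residual has decayed by `exp (-Γ)` on the information space,
and on the nuisance space it has not grown. -/
theorem norm_linearIter_le (hA : ∀ w, (A w).ofLp = J *ᵥ w.ofLp) {η β α Γ : ℝ} (hη : 0 ≤ η)
    (hAβ : ‖A‖ ≤ β) (hηβ : η * β ^ 2 ≤ 1) (hα : 0 < α) {T : ℕ} (hT : η * T = Γ / α ^ 2)
    (q : EuclideanSpace ℝ m) :
    ‖linearIter A η q T‖
      ≤ ‖(nuisanceSpace J α).starProjection q‖ + Real.exp (-Γ) * ‖q‖ := by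
  have hs1 : ∀ s, η * singularValue J s ^ 2 ≤ 1 := fun s => by
    refine le_trans ?_ hηβ
    have := singularValue_nonneg J s
    gcongr
    exact (singularValue_le hA s).trans hAβ
  refine abs_le_of_sq_le_sq' ?_ (by positivity) |>.2
  rw [norm_sq_eq_sum_inner_sq J, ← Finset.sum_filter_add_sum_filter_not _
    (fun s => singularValue J s < α)]
  have h1 : ∑ s with singularValue J s < α, ⟪leftSingularVector J s, linearIter A η q T⟫ ^ 2
      ≤ ‖(nuisanceSpace J α).starProjection q‖ ^ 2 := by
    refine (Finset.sum_le_sum fun s _ => ?_).trans (sum_nuisance_sq_le J α q)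
    rw [inner_linearIter hA, mul_pow]
    refine mul_le_of_le_one_left (sq_nonneg _) (pow_le_one₀ (pow_nonneg ?_ _)
      (pow_le_one₀ ?_ ?_)) <;> nlinarith [hs1 s, sq_nonneg (singularValue J s)]
  have h2 : ∑ s with ¬ singularValue J s < α, ⟪leftSingularVector J s, linearIter A η q T⟫ ^ 2
      ≤ (Real.exp (-Γ) * ‖q‖) ^ 2 := by
    rw [mul_pow, norm_sq_eq_sum_inner_sq J q, Finset.mul_sum]
    refine (Finset.sum_le_sum fun s hs => ?_).trans
      (Finset.sum_le_univ_sum_of_nonneg fun s => by positivity)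
    have hsα : α ≤ singularValue J s := not_lt.1 (Finset.mem_filter.1 hs).2
    rw [inner_linearIter hA, mul_pow]
    have h0 : 0 ≤ 1 - η * singularValue J s ^ 2 := by linarith [hs1 s]
    have hp : (1 - η * singularValue J s ^ 2) ^ T ≤ Real.exp (-Γ) := by
      have e1 : 1 - η * singularValue J s ^ 2 ≤ Real.exp (-(η * singularValue J s ^ 2)) := by
        have := Real.add_one_le_exp (-(η * singularValue J s ^ 2))
        linarith
      refine (pow_le_pow_left₀ h0 e1 T).trans ?_
      rw [← Real.exp_nat_mul]
      refine Real.exp_le_exp.2 ?_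
      have e2 : Γ = η * T * α ^ 2 := by rw [hT]; field_simp
      have e3 : η * T * α ^ 2 ≤ η * T * singularValue J s ^ 2 := by gcongr
      rw [e2]; linarith
    gcongr
  have h3 : 0 ≤ ‖(nuisanceSpace J α).starProjection q‖ * (Real.exp (-Γ) * ‖q‖) := by positivity
  nlinarith

/-- Distance travelled by linearised gradient descent: at most the minimal-norm correction on the
information space, and at most the trivial bound `η T λ_s ≤ Γ / α` on the nuisance space. -/
theorem norm_sum_adjoint_linearIter_le [DecidableEq p] (hA : ∀ w, (A w).ofLp = J *ᵥ w.ofLp)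
    {η β α Γ : ℝ} (hη : 0 ≤ η) (hAβ : ‖A‖ ≤ β) (hηβ : η * β ^ 2 ≤ 1) (hα : 0 < α) (hΓ : 0 ≤ Γ)
    {T : ℕ} (hT : η * T = Γ / α ^ 2) (q : EuclideanSpace ℝ m) :
    ‖η • ∑ t ∈ range T, adjoint A (linearIter A η q t)‖
      ≤ ‖WithLp.toLp 2 (pseudoInverse (truncated J α) *ᵥ q.ofLp)‖
        + Γ / α * ‖(nuisanceSpace J α).starProjection q‖ := by
  set z := η • ∑ t ∈ range T, linearIter A η q t with hz
  have hzA : η • ∑ t ∈ range T, adjoint A (linearIter A η q t) = adjoint A z := by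
    rw [hz, map_smul, map_sum]
  set a : m → ℝ := fun s => η * ∑ t ∈ range T, (1 - η * singularValue J s ^ 2) ^ t with ha
  have hza : ∀ s, ⟪leftSingularVector J s, z⟫ = a s * ⟪leftSingularVector J s, q⟫ := by
    intro s
    rw [hz, real_inner_smul_right, inner_sum]
    simp only [inner_linearIter hA, ← Finset.sum_mul, ha, mul_assoc]
  have hnorm : ‖adjoint A z‖ ^ 2
      = ∑ s, (singularValue J s * a s * ⟪leftSingularVector J s, q⟫) ^ 2 := by
    rw [← real_inner_self_eq_norm_sq, adjoint_inner_left,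
      ← (Matrix.isHermitian_mul_conjTranspose_self J).eigenvectorBasis.sum_inner_mul_inner]
    refine Finset.sum_congr rfl fun s _ => ?_
    change ⟪z, leftSingularVector J s⟫ * ⟪leftSingularVector J s, _⟫ = _
    rw [real_inner_comm, inner_apply_adjoint hA, hza]
    ring
  have h0 : ∀ s, 0 ≤ 1 - η * singularValue J s ^ 2 := fun s => by
    refine sub_nonneg.2 (le_trans ?_ hηβ)
    have := singularValue_nonneg J s
    gcongr
    exact (singularValue_le hA s).trans hAβ
  have ha0 : ∀ s, 0 ≤ a s := fun s =>
    mul_nonneg hη (Finset.sum_nonneg fun t _ => pow_nonneg (h0 s) t)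
  have haT : ∀ s, a s ≤ Γ / α ^ 2 := by
    intro s
    rw [← hT]
    simp only [ha]
    gcongr
    have := Finset.sum_le_card_nsmul (range T) (fun t => (1 - η * singularValue J s ^ 2) ^ t) 1
      fun t _ => pow_le_one₀ (h0 s) (by
        have := mul_nonneg hη (sq_nonneg (singularValue J s)); linarith)
    simpa using this
  have hgeo : ∀ s, singularValue J s ^ 2 * a s ≤ 1 := by
    intro s
    have := geom_sum_mul_neg (1 - η * singularValue J s ^ 2) T
    have e : singularValue J s ^ 2 * a s = 1 - (1 - η * singularValue J s ^ 2) ^ T := by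
      rw [← this]; simp only [ha]; ring
    rw [e]
    linarith [pow_nonneg (h0 s) T]
  rw [hzA]
  refine abs_le_of_sq_le_sq' ?_ (by positivity) |>.2
  rw [hnorm, ← Finset.sum_filter_add_sum_filter_not _ (fun s => singularValue J s < α)]
  have h1 : ∑ s with singularValue J s < α,
        (singularValue J s * a s * ⟪leftSingularVector J s, q⟫) ^ 2
      ≤ (Γ / α * ‖(nuisanceSpace J α).starProjection q‖) ^ 2 := by
    rw [mul_pow]
    refine le_trans ?_ (mul_le_mul_of_nonneg_left (sum_nuisance_sq_le J α q) (sq_nonneg (Γ / α)))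
    rw [Finset.mul_sum]
    refine Finset.sum_le_sum fun s hs => ?_
    have hsα := (Finset.mem_filter.1 hs).2
    rw [mul_pow]
    have hb : singularValue J s * a s ≤ Γ / α := by
      calc singularValue J s * a s ≤ α * (Γ / α ^ 2) :=
            mul_le_mul hsα.le (haT s) (ha0 s) hα.le
        _ = Γ / α := by field_simp
    have := mul_nonneg (singularValue_nonneg J s) (ha0 s)
    gcongr
  have h2 : ∑ s with ¬ singularValue J s < α,
        (singularValue J s * a s * ⟪leftSingularVector J s, q⟫) ^ 2
      ≤ ‖WithLp.toLp 2 (pseudoInverse (truncated J α) *ᵥ q.ofLp)‖ ^ 2 := by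
    refine (Finset.sum_le_sum fun s hs => ?_).trans (sum_info_sq_div_le J hα q)
    have hpos : 0 < singularValue J s := hα.trans_le (not_lt.1 (Finset.mem_filter.1 hs).2)
    rw [mul_pow, div_pow, div_eq_inv_mul, ← inv_pow]
    have hb : singularValue J s * a s ≤ (singularValue J s)⁻¹ := by
      rw [← one_div, le_div_iff₀ hpos]
      linarith [hgeo s]
    have := mul_nonneg hpos.le (ha0 s)
    gcongr
  have h3 : 0 ≤ ‖WithLp.toLp 2 (pseudoInverse (truncated J α) *ᵥ q.ofLp)‖
      * (Γ / α * ‖(nuisanceSpace J α).starProjection q‖) := by positivity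
  nlinarith

end Iterates

end Spectral

/-! ### The network: derivatives, Lipschitz bounds and linearisation -/

section NetworkBounds

open scoped RealInnerProductSpace

variable {n d k K : ℕ}

/-- The pre-activation `⟨w_s, x⟩` of the hidden unit `s`. -/
def preact (W : Weights k d) (x : EuclideanSpace ℝ (Fin d)) (s : Fin k) : ℝ :=
  ∑ j, W (s, j) * x j

theorem preact_add (W U : Weights k d) (x : EuclideanSpace ℝ (Fin d)) (s : Fin k) :
    preact (W + U) x s = preact W x s + preact U x s := by
  simp [preact, add_mul, Finset.sum_add_distrib]

theorem preact_smul (c : ℝ) (U : Weights k d) (x : EuclideanSpace ℝ (Fin d)) (s : Fin k) :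
    preact (c • U) x s = c * preact U x s := by
  simp [preact, mul_assoc, Finset.mul_sum]

theorem preact_sub (W U : Weights k d) (x : EuclideanSpace ℝ (Fin d)) (s : Fin k) :
    preact (W - U) x s = preact W x s - preact U x s := by
  simp [preact, sub_mul, Finset.sum_sub_distrib]

theorem sum_preact_sq_le (U : Weights k d) (x : EuclideanSpace ℝ (Fin d)) :
    ∑ s, preact U x s ^ 2 ≤ ‖U‖ ^ 2 * ‖x‖ ^ 2 := by
  rw [EuclideanSpace.real_norm_sq_eq U, EuclideanSpace.real_norm_sq_eq x, Fintype.sum_prod_type,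
    Finset.sum_mul]
  exact Finset.sum_le_sum fun s _ => Finset.sum_mul_sq_le_sq_mul_sq _ _ _

theorem sum_sum_preact_sq_le (S : Fin n → Example d K) (U : Weights k d) :
    ∑ i, ∑ s, preact U (S i).1 s ^ 2 ≤ ‖dataMatrix S‖ ^ 2 * ‖U‖ ^ 2 := by
  rw [Finset.sum_comm, EuclideanSpace.real_norm_sq_eq U, Fintype.sum_prod_type, Finset.mul_sum]
  refine Finset.sum_le_sum fun s _ => ?_
  have h := Matrix.l2_opNorm_mulVec (dataMatrix S) (WithLp.toLp 2 fun j => U (s, j))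
  have h2 := pow_le_pow_left₀ (norm_nonneg _) h 2
  rw [mul_pow, EuclideanSpace.real_norm_sq_eq, EuclideanSpace.real_norm_sq_eq] at h2
  refine le_trans (le_of_eq (Finset.sum_congr rfl fun i _ => ?_)) h2
  simp [preact, dataMatrix, Matrix.mulVec, dotProduct, mul_comm]

/-- Bound on the output layer: cross-weighted sums over hidden units, squared over output units. -/
theorem sum_sq_sum_mul_le {V : Matrix (Fin K) (Fin k) ℝ} {ν : ℝ} (hν : 0 ≤ ν) (hk : 0 < k)
    (hV : ∀ l s, |V l s| ≤ ν / √((k : ℝ) * K)) {b : Fin k → ℝ} {M : ℝ}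
    (hb : ∑ s, |b s| ≤ M) : ∑ l, (∑ s, V l s * b s) ^ 2 ≤ (ν / √k * M) ^ 2 := by
  rcases Nat.eq_zero_or_pos K with rfl | hK
  · simp; positivity
  have hk' : (0:ℝ) < k := by exact_mod_cast hk
  have hK' : (0:ℝ) < K := by exact_mod_cast hK
  have h1 : ∀ l, (∑ s, V l s * b s) ^ 2 ≤ (ν / √((k : ℝ) * K) * M) ^ 2 := by
    intro l
    rw [← sq_abs]
    have hle : |∑ s, V l s * b s| ≤ ν / √((k : ℝ) * K) * M := by
      refine (Finset.abs_sum_le_sum_abs _ _).trans ?_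
      refine le_trans ?_ (mul_le_mul_of_nonneg_left hb (by positivity))
      rw [Finset.mul_sum]
      refine Finset.sum_le_sum fun s _ => ?_
      rw [abs_mul]
      gcongr
      exact hV l s
    gcongr
  refine (Finset.sum_le_sum fun l _ => h1 l).trans (le_of_eq ?_)
  rw [Finset.sum_const, Finset.card_univ, Fintype.card_fin, nsmul_eq_mul, mul_pow, mul_pow,
    div_pow, div_pow, Real.sq_sqrt (by positivity), Real.sq_sqrt (by positivity)]
  field_simp

/-- The derivative of `W ↦ f(W)`, as an explicit linear map. -/
def predictionsDeriv (V : Matrix (Fin K) (Fin k) ℝ) (φ : ℝ → ℝ) (S : Fin n → Example d K)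
    (W : Weights k d) : Weights k d →L[ℝ] EuclideanSpace ℝ (Fin n × Fin K) :=
  LinearMap.toContinuousLinearMap
    { toFun := fun U => WithLp.toLp 2 fun q =>
        ∑ s, V q.2 s * (deriv φ (preact W (S q.1).1 s) * preact U (S q.1).1 s)
      map_add' := fun U U' => by
        ext q; simp [preact_add, mul_add, Finset.sum_add_distrib]
      map_smul' := fun c U => by
        ext q
        simp only [preact_smul, PiLp.smul_apply, smul_eq_mul, RingHom.id_apply, Finset.mul_sum]
        exact Finset.sum_congr rfl fun s _ => by ring }

theorem predictionsDeriv_apply (V : Matrix (Fin K) (Fin k) ℝ) (φ : ℝ → ℝ)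
    (S : Fin n → Example d K) (W U : Weights k d) (q : Fin n × Fin K) :
    predictionsDeriv V φ S W U q
      = ∑ s, V q.2 s * (deriv φ (preact W (S q.1).1 s) * preact U (S q.1).1 s) := rfl

theorem hasFDerivAt_preact (W : Weights k d) (x : EuclideanSpace ℝ (Fin d)) (s : Fin k) :
    HasFDerivAt (fun W : Weights k d => preact W x s)
      (LinearMap.toContinuousLinearMap
        { toFun := fun U : Weights k d => preact U x s
          map_add' := fun U U' => preact_add U U' x s
          map_smul' := fun c U => preact_smul c U x s }) W :=
  (LinearMap.toContinuousLinearMap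
        { toFun := fun U : Weights k d => preact U x s
          map_add' := fun U U' => preact_add U U' x s
          map_smul' := fun c U => preact_smul c U x s }).hasFDerivAt

theorem hasFDerivAt_predictions {φ : ℝ → ℝ} (hφ : Differentiable ℝ φ)
    (V : Matrix (Fin K) (Fin k) ℝ) (S : Fin n → Example d K) (W : Weights k d) :
    HasFDerivAt (predictions V φ S) (predictionsDeriv V φ S W) W := by
  rw [← hasFDerivWithinAt_univ, hasFDerivWithinAt_euclidean]
  intro q
  rw [hasFDerivWithinAt_univ]
  have h := HasFDerivAt.fun_sum (u := Finset.univ) fun s _ =>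
    ((hφ (preact W (S q.1).1 s)).hasDerivAt.comp_hasFDerivAt W
      (hasFDerivAt_preact W (S q.1).1 s)).const_mul (V q.2 s)
  refine h.congr_fderiv ?_
  ext U
  simp [predictionsDeriv_apply]

theorem fderiv_predictions {φ : ℝ → ℝ} (hφ : Differentiable ℝ φ)
    (V : Matrix (Fin K) (Fin k) ℝ) (S : Fin n → Example d K) (W : Weights k d) :
    fderiv ℝ (predictions V φ S) W = predictionsDeriv V φ S W :=
  (hasFDerivAt_predictions hφ V S W).fderiv

theorem fderiv_predictions_ofLp (V : Matrix (Fin K) (Fin k) ℝ) (φ : ℝ → ℝ)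
    (S : Fin n → Example d K) (W U : Weights k d) :
    (fderiv ℝ (predictions V φ S) W U).ofLp = jacobian V φ S W *ᵥ U.ofLp := by
  have hU : U = ∑ r, U r • EuclideanSpace.single r (1:ℝ) := by
    ext r
    simp [Finset.sum_apply, Pi.single_apply]
  ext q
  conv_lhs => rw [hU]
  simp [jacobian, Matrix.mulVec, dotProduct, mul_comm]

theorem norm_fderiv_predictions_le {φ : ℝ → ℝ} (hφ : Differentiable ℝ φ) {B ν : ℝ} (hB : 0 ≤ B)
    (hν : 0 ≤ ν) (hk : 0 < k) (hφ' : ∀ t, |deriv φ t| ≤ B) {V : Matrix (Fin K) (Fin k) ℝ}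
    (hV : ∀ l s, |V l s| ≤ ν / √((k : ℝ) * K)) (S : Fin n → Example d K) (W : Weights k d) :
    ‖fderiv ℝ (predictions V φ S) W‖ ≤ ν * B * ‖dataMatrix S‖ := by
  rw [fderiv_predictions hφ]
  refine ContinuousLinearMap.opNorm_le_bound _ (by positivity) fun U => ?_
  refine abs_le_of_sq_le_sq' ?_ (by positivity) |>.2
  rw [EuclideanSpace.real_norm_sq_eq, Fintype.sum_prod_type]
  have hk' : (0:ℝ) < k := by exact_mod_cast hk
  have h1 : ∀ i, ∑ l, predictionsDeriv V φ S W U (i, l) ^ 2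
      ≤ ν ^ 2 * B ^ 2 * ∑ s, preact U (S i).1 s ^ 2 := by
    intro i
    simp only [predictionsDeriv_apply]
    refine (sum_sq_sum_mul_le hν hk hV (M := √k * (B * √(∑ s, preact U (S i).1 s ^ 2))) ?_).trans
      (le_of_eq ?_)
    · have hcs := Real.sum_mul_le_sqrt_mul_sqrt Finset.univ (fun _ : Fin k => (1:ℝ))
        fun s => |preact U (S i).1 s|
      simp only [one_mul, one_pow, Finset.sum_const, Finset.card_univ, Fintype.card_fin,
        nsmul_eq_mul, mul_one, sq_abs] at hcs
      calc ∑ s, |deriv φ (preact W (S i).1 s) * preact U (S i).1 s|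
          ≤ ∑ s, B * |preact U (S i).1 s| := by
            refine Finset.sum_le_sum fun s _ => ?_
            rw [abs_mul]
            gcongr
            exact hφ' _
        _ = B * ∑ s, |preact U (S i).1 s| := by rw [Finset.mul_sum]
        _ ≤ B * (√k * √(∑ s, preact U (S i).1 s ^ 2)) := by gcongr
        _ = _ := by ring
    · have e : ν / √k * (√k * (B * √(∑ s, preact U (S i).1 s ^ 2)))
          = ν * B * √(∑ s, preact U (S i).1 s ^ 2) := by field_simp
      rw [e, mul_pow, Real.sq_sqrt (by positivity)]
      ring
  calc ∑ i, ∑ l, predictionsDeriv V φ S W U (i, l) ^ 2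
      ≤ ∑ i, ν ^ 2 * B ^ 2 * ∑ s, preact U (S i).1 s ^ 2 := Finset.sum_le_sum fun i _ => h1 i
    _ = ν ^ 2 * B ^ 2 * ∑ i, ∑ s, preact U (S i).1 s ^ 2 := by rw [← Finset.mul_sum]
    _ ≤ ν ^ 2 * B ^ 2 * (‖dataMatrix S‖ ^ 2 * ‖U‖ ^ 2) := by
        gcongr; exact sum_sum_preact_sq_le S U
    _ = _ := by ring

theorem abs_deriv_sub_le {φ : ℝ → ℝ} {B : ℝ} (hφ2 : Differentiable ℝ (deriv φ))
    (hφ'' : ∀ t, |deriv (deriv φ) t| ≤ B) (a b : ℝ) : |deriv φ a - deriv φ b| ≤ B * |a - b| :=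
  convex_univ.norm_image_sub_le_of_norm_deriv_le (fun x _ => hφ2 x) (fun x _ => hφ'' x)
    (Set.mem_univ b) (Set.mem_univ a)

theorem abs_taylor_le {φ : ℝ → ℝ} {B : ℝ} (hB : 0 ≤ B) (hφ : Differentiable ℝ φ)
    (hφ2 : Differentiable ℝ (deriv φ)) (hφ'' : ∀ t, |deriv (deriv φ) t| ≤ B) (a b : ℝ) :
    |φ (a + b) - (φ a + deriv φ a * b)| ≤ B * b ^ 2 := by
  have h := Convex.norm_image_sub_le_of_norm_hasDerivWithin_le (s := Metric.closedBall a |b|)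
    (f := fun x => φ x - deriv φ a * x) (f' := fun x => deriv φ x - deriv φ a) (C := B * |b|)
    (x := a) (y := a + b)
    (fun x _ => (((hφ x).hasDerivAt).sub
      (by simpa using (hasDerivAt_id x).const_mul (deriv φ a))).hasDerivWithinAt)
    (fun x hx => (abs_deriv_sub_le hφ2 hφ'' x a).trans 
      (mul_le_mul_of_nonneg_left (Metric.mem_closedBall.1 hx) hB)) (convex_closedBall _ _) (by simp) (by simp)
  have e : φ (a + b) - deriv φ a * (a + b) - (φ a - deriv φ a * a)
      = φ (a + b) - (φ a + deriv φ a * b) := by ring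
  rw [e, Real.norm_eq_abs, Real.norm_eq_abs, add_sub_cancel_left, mul_assoc, abs_mul_abs_self] at h
  rw [sq]
  exact h

theorem norm_fderiv_predictions_sub_le {φ : ℝ → ℝ} (hφ : Differentiable ℝ φ)
    (hφ2 : Differentiable ℝ (deriv φ)) {B ν : ℝ} (hB : 0 ≤ B) (hν : 0 ≤ ν) (hk : 0 < k)
    (hφ'' : ∀ t, |deriv (deriv φ) t| ≤ B) {V : Matrix (Fin K) (Fin k) ℝ}
    (hV : ∀ l s, |V l s| ≤ ν / √((k : ℝ) * K)) {S : Fin n → Example d K}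
    (hS : ∀ i, ‖(S i).1‖ = 1) (W W' : Weights k d) :
    ‖fderiv ℝ (predictions V φ S) W - fderiv ℝ (predictions V φ S) W'‖
      ≤ ν * B * ‖dataMatrix S‖ / √k * ‖W - W'‖ := by
  rw [fderiv_predictions hφ, fderiv_predictions hφ]
  refine ContinuousLinearMap.opNorm_le_bound _ (by positivity) fun U => ?_
  refine abs_le_of_sq_le_sq' ?_ (by positivity) |>.2
  rw [EuclideanSpace.real_norm_sq_eq, Fintype.sum_prod_type]
  have h1 : ∀ i, ∑ l, ((predictionsDeriv V φ S W - predictionsDeriv V φ S W') U (i, l)) ^ 2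
      ≤ (ν / √k * B * ‖W - W'‖) ^ 2 * ∑ s, preact U (S i).1 s ^ 2 := by
    intro i
    have e : ∀ l, (predictionsDeriv V φ S W - predictionsDeriv V φ S W') U (i, l)
        = ∑ s, V l s * ((deriv φ (preact W (S i).1 s) - deriv φ (preact W' (S i).1 s))
          * preact U (S i).1 s) := by
      intro l
      rw [sub_apply, PiLp.sub_apply, predictionsDeriv_apply,
        predictionsDeriv_apply, ← Finset.sum_sub_distrib]
      exact Finset.sum_congr rfl fun s _ => by ring
    simp only [e]
    refine (sum_sq_sum_mul_le hν hk hV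
      (M := B * (‖W - W'‖ * √(∑ s, preact U (S i).1 s ^ 2))) ?_).trans (le_of_eq ?_)
    · have hcs := Real.sum_mul_le_sqrt_mul_sqrt Finset.univ
        (fun s => |preact (W - W') (S i).1 s|) fun s => |preact U (S i).1 s|
      simp only [sq_abs] at hcs
      have hΔ : √(∑ s, preact (W - W') (S i).1 s ^ 2) ≤ ‖W - W'‖ := by
        refine Real.sqrt_le_iff.2 ⟨norm_nonneg _, ?_⟩
        simpa [hS i] using sum_preact_sq_le (W - W') (S i).1
      calc ∑ s, |(deriv φ (preact W (S i).1 s) - deriv φ (preact W' (S i).1 s))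
            * preact U (S i).1 s|
          ≤ ∑ s, B * (|preact (W - W') (S i).1 s| * |preact U (S i).1 s|) := by
            refine Finset.sum_le_sum fun s _ => ?_
            rw [abs_mul, ← mul_assoc, preact_sub]
            gcongr
            exact abs_deriv_sub_le hφ2 hφ'' _ _
        _ = B * ∑ s, |preact (W - W') (S i).1 s| * |preact U (S i).1 s| := by rw [Finset.mul_sum]
        _ ≤ B * (√(∑ s, preact (W - W') (S i).1 s ^ 2) * √(∑ s, preact U (S i).1 s ^ 2)) := by
            gcongr
        _ ≤ _ := by gcongr
    · rw [show ν / √k * (B * (‖W - W'‖ * √(∑ s, preact U (S i).1 s ^ 2)))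
        = ν / √k * B * ‖W - W'‖ * √(∑ s, preact U (S i).1 s ^ 2) by ring, mul_pow,
        Real.sq_sqrt (by positivity)]
  calc _ ≤ ∑ i, (ν / √k * B * ‖W - W'‖) ^ 2 * ∑ s, preact U (S i).1 s ^ 2 :=
        Finset.sum_le_sum fun i _ => h1 i
    _ = (ν / √k * B * ‖W - W'‖) ^ 2 * ∑ i, ∑ s, preact U (S i).1 s ^ 2 := by
        rw [← Finset.mul_sum]
    _ ≤ (ν / √k * B * ‖W - W'‖) ^ 2 * (‖dataMatrix S‖ ^ 2 * ‖U‖ ^ 2) := by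
        gcongr; exact sum_sum_preact_sq_le S U
    _ = _ := by ring

theorem norm_dataMatrix_le {S : Fin n → Example d K} (hS : ∀ i, ‖(S i).1‖ = 1) :
    ‖dataMatrix S‖ ≤ √n := by
  rw [Matrix.l2_opNorm_def]
  refine ContinuousLinearMap.opNorm_le_bound _ (Real.sqrt_nonneg _) fun u => ?_
  refine abs_le_of_sq_le_sq' ?_ (by positivity) |>.2
  rw [mul_pow, Real.sq_sqrt (Nat.cast_nonneg n), EuclideanSpace.real_norm_sq_eq]
  have h1 : ∀ i, ((dataMatrix S *ᵥ u.ofLp) i) ^ 2 ≤ ‖u‖ ^ 2 := by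
    intro i
    have h := Finset.sum_mul_sq_le_sq_mul_sq Finset.univ (fun j => (S i).1 j) fun j => u j
    rw [← EuclideanSpace.real_norm_sq_eq, ← EuclideanSpace.real_norm_sq_eq, hS i] at h
    simpa [dataMatrix, Matrix.mulVec, dotProduct] using h
  calc _ ≤ ∑ _i : Fin n, ‖u‖ ^ 2 := Finset.sum_le_sum fun i _ => h1 i
    _ = _ := by simp

theorem gradDescent_succ {φ : ℝ → ℝ} (hφ : Differentiable ℝ φ) (V : Matrix (Fin K) (Fin k) ℝ)
    (S : Fin n → Example d K) (η : ℝ) (W₀ : Weights k d) (t : ℕ) :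
    gradDescent V φ S η W₀ (t + 1) = gradDescent V φ S η W₀ t
      - η • ContinuousLinearMap.adjoint
          (fderiv ℝ (predictions V φ S) (gradDescent V φ S η W₀ t))
          (predictions V φ S (gradDescent V φ S η W₀ t) - labels S) := by
  have hloss : loss V φ S = fun W => 1 / 2 * ‖predictions V φ S W - labels S‖ ^ 2 := by
    funext W
    simp only [loss, EuclideanSpace.real_norm_sq_eq]
    rw [Fintype.sum_prod_type]
    rfl
  have hgrad : ∀ W, gradient (loss V φ S) W = ContinuousLinearMap.adjoint
      (fderiv ℝ (predictions V φ S) W) (predictions V φ S W - labels S) := by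
    intro W
    refine HasGradientAt.gradient ?_
    rw [hasGradientAt_iff_hasFDerivAt, hloss, fderiv_predictions hφ]
    refine ((((hasFDerivAt_predictions hφ V S W).sub_const (labels S)).norm_sq).const_mul
      (1 / 2 : ℝ)).congr_fderiv ?_
    ext U
    simp [ContinuousLinearMap.adjoint_inner_left]
  rw [gradDescent, hgrad]

end NetworkBounds

/-! ### The surrogate loss of the linearised network -/

section Surrogate

open scoped RealInnerProductSpace

variable {n d k K : ℕ}

/-- The gradient at `W₀` of the `l`-th output at `x`, for `‖x‖ ≤ 1`; for larger inputs it is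
rescaled by `‖x‖⁻¹`, which makes it bounded without changing it on the unit sphere. -/
def outputGrad (V : Matrix (Fin K) (Fin k) ℝ) (φ : ℝ → ℝ) (W₀ : Weights k d) (l : Fin K)
    (x : EuclideanSpace ℝ (Fin d)) : Weights k d :=
  (max 1 ‖x‖)⁻¹ • WithLp.toLp 2 fun r => V l r.1 * deriv φ (preact W₀ x r.1) * x r.2

/-- The loss `min 1 (√2 ‖f - y‖)` of the network linearised at `W₀`, with displacement `U`. It is
at least `1` whenever the linearised network misclassifies. -/
def surrogate (V : Matrix (Fin K) (Fin k) ℝ) (φ : ℝ → ℝ) (W₀ U : Weights k d)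
    (z : Example d K) : ℝ :=
  min 1 (√2 * ‖(WithLp.toLp 2 fun l => net V φ W₀ z.1 l + ⟪outputGrad V φ W₀ l z.1, U⟫)
    - z.2‖)

theorem inner_outputGrad (V : Matrix (Fin K) (Fin k) ℝ) (φ : ℝ → ℝ) (W₀ U : Weights k d)
    (l : Fin K) (x : EuclideanSpace ℝ (Fin d)) :
    ⟪outputGrad V φ W₀ l x, U⟫
      = (max 1 ‖x‖)⁻¹ * ∑ s, V l s * (deriv φ (preact W₀ x s) * preact U x s) := by
  rw [outputGrad, real_inner_smul_left, EuclideanSpace.inner_eq_star_dotProduct]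
  congr 1
  simp only [star_trivial, dotProduct, Fintype.sum_prod_type, preact, Finset.mul_sum]
  exact Finset.sum_congr rfl fun s _ => Finset.sum_congr rfl fun j _ => by ring

theorem sum_norm_outputGrad_sq_le {φ : ℝ → ℝ} {B ν : ℝ} (hν : 0 ≤ ν)
    (hφ' : ∀ t, |deriv φ t| ≤ B) {V : Matrix (Fin K) (Fin k) ℝ}
    (hV : ∀ l s, |V l s| ≤ ν / √((k : ℝ) * K)) (W₀ : Weights k d) (x : EuclideanSpace ℝ (Fin d)) :
    ∑ l, ‖outputGrad V φ W₀ l x‖ ^ 2 ≤ (ν * B) ^ 2 := by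
  rcases Nat.eq_zero_or_pos K with rfl | hK
  · simp; positivity
  rcases Nat.eq_zero_or_pos k with rfl | hk
  · have : ∀ l, outputGrad V φ W₀ l x = 0 := fun l => Subsingleton.elim _ _
    simp [this]; positivity
  have hk' : (0:ℝ) < k := by exact_mod_cast hk
  have hK' : (0:ℝ) < K := by exact_mod_cast hK
  have h1 : ∀ l, ‖outputGrad V φ W₀ l x‖ ^ 2 ≤ (ν * B) ^ 2 / K := by
    intro l
    have hm : 0 < max 1 ‖x‖ := lt_max_of_lt_left one_pos
    rw [outputGrad, norm_smul, mul_pow, norm_inv, Real.norm_of_nonneg hm.le, inv_pow,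
      inv_mul_le_iff₀ (by positivity), EuclideanSpace.real_norm_sq_eq, Fintype.sum_prod_type]
    have h2 : ∀ s, ∑ j, (V l s * deriv φ (preact W₀ x s) * x j) ^ 2
        ≤ (ν / √((k : ℝ) * K) * B) ^ 2 * max 1 ‖x‖ ^ 2 := by
      intro s
      simp only [mul_pow _ (x _), ← Finset.mul_sum]
      rw [← EuclideanSpace.real_norm_sq_eq]
      have h3 : (V l s * deriv φ (preact W₀ x s)) ^ 2 ≤ (ν / √((k : ℝ) * K) * B) ^ 2 := by
        rw [← sq_abs, abs_mul]
        gcongr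
        · exact hV l s
        · exact hφ' _
      gcongr
      exact le_max_right _ _
    refine (Finset.sum_le_sum fun s _ => h2 s).trans (le_of_eq ?_)
    rw [Finset.sum_const, Finset.card_univ, Fintype.card_fin, nsmul_eq_mul, mul_pow, div_pow,
      Real.sq_sqrt (by positivity)]
    field_simp
  refine (Finset.sum_le_sum fun l _ => h1 l).trans (le_of_eq ?_)
  rw [Finset.sum_const, Finset.card_univ, Fintype.card_fin, nsmul_eq_mul]
  field_simp

theorem measurable_outputGrad {φ : ℝ → ℝ} (V : Matrix (Fin K) (Fin k) ℝ) (W₀ : Weights k d)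
    (l : Fin K) : Measurable fun z : Example d K => outputGrad V φ W₀ l z.1 := by
  unfold outputGrad preact
  have h : Measurable (deriv φ) := measurable_deriv φ
  have hm : Measurable fun z : Example d K => (max 1 ‖z.1‖)⁻¹ := by fun_prop
  refine hm.smul ?_
  refine (PiLp.continuous_toLp 2 _).measurable.comp (measurable_pi_iff.2 fun r => ?_)
  fun_prop

theorem measurable_surrogate {φ : ℝ → ℝ} (hφ : Continuous φ) (V : Matrix (Fin K) (Fin k) ℝ)
    (W₀ U : Weights k d) : Measurable (surrogate V φ W₀ U) := by
  unfold surrogate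
  refine measurable_const.min ((Measurable.norm (Measurable.sub ?_ measurable_snd)).const_mul _)
  refine (PiLp.continuous_toLp 2 _).measurable.comp (measurable_pi_iff.2 fun l => ?_)
  refine Measurable.add ?_ ((measurable_outputGrad V W₀ l).inner measurable_const)
  have := hφ.measurable
  simp only [net]
  fun_prop

theorem surrogate_nonneg (V : Matrix (Fin K) (Fin k) ℝ) (φ : ℝ → ℝ) (W₀ U : Weights k d)
    (z : Example d K) : 0 ≤ surrogate V φ W₀ U z := le_min zero_le_one (by positivity)

theorem surrogate_le_one (V : Matrix (Fin K) (Fin k) ℝ) (φ : ℝ → ℝ) (W₀ U : Weights k d)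
    (z : Example d K) : surrogate V φ W₀ U z ≤ 1 := min_le_left _ _

theorem abs_surrogate_sub_le (V : Matrix (Fin K) (Fin k) ℝ) (φ : ℝ → ℝ) (W₀ U U' : Weights k d)
    (z : Example d K) : |surrogate V φ W₀ U z - surrogate V φ W₀ U' z|
      ≤ √2 * √(∑ l, (⟪outputGrad V φ W₀ l z.1, U⟫ - ⟪outputGrad V φ W₀ l z.1, U'⟫) ^ 2) := by
  unfold surrogate
  refine (abs_min_sub_min_le_max _ _ _ _).trans (max_le (by simp) ?_)
  rw [← mul_sub, abs_mul, abs_of_nonneg (Real.sqrt_nonneg _)]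
  gcongr
  refine (abs_norm_sub_norm_le _ _).trans (le_of_eq ?_)
  rw [sub_sub_sub_cancel_right, EuclideanSpace.norm_eq]
  simp

/-- Second-order remainder of the network at a unit input. -/
theorem norm_net_sub_linear_le {φ : ℝ → ℝ} (hφ : Differentiable ℝ φ)
    (hφ2 : Differentiable ℝ (deriv φ)) {B ν : ℝ} (hB : 0 ≤ B) (hν : 0 ≤ ν) (hk : 0 < k)
    (hφ'' : ∀ t, |deriv (deriv φ) t| ≤ B) {V : Matrix (Fin K) (Fin k) ℝ}
    (hV : ∀ l s, |V l s| ≤ ν / √((k : ℝ) * K)) (W₀ U : Weights k d)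
    {x : EuclideanSpace ℝ (Fin d)} (hx : ‖x‖ = 1) :
    ‖net V φ (W₀ + U) x
        - WithLp.toLp 2 fun l => net V φ W₀ x l + ⟪outputGrad V φ W₀ l x, U⟫‖
      ≤ ν / √k * (B * ‖U‖ ^ 2) := by
  refine abs_le_of_sq_le_sq' ?_ (by positivity) |>.2
  rw [EuclideanSpace.real_norm_sq_eq]
  have e : ∀ l, (net V φ (W₀ + U) x
        - WithLp.toLp 2 fun l => net V φ W₀ x l + ⟪outputGrad V φ W₀ l x, U⟫) l
      = ∑ s, V l s * (φ (preact W₀ x s + preact U x s)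
          - (φ (preact W₀ x s) + deriv φ (preact W₀ x s) * preact U x s)) := by
    intro l
    have h1 : ∀ W : Weights k d, net V φ W x l = ∑ s, V l s * φ (preact W x s) := fun W => rfl
    rw [PiLp.sub_apply]
    simp only [h1, inner_outputGrad, hx, max_self, inv_one, one_mul, preact_add]
    rw [← Finset.sum_add_distrib, ← Finset.sum_sub_distrib]
    exact Finset.sum_congr rfl fun s _ => by ring
  simp only [e]
  refine sum_sq_sum_mul_le hν hk hV ?_
  calc _ ≤ ∑ s, B * preact U x s ^ 2 :=
        Finset.sum_le_sum fun s _ => abs_taylor_le hB hφ hφ2 hφ'' _ _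
    _ = B * ∑ s, preact U x s ^ 2 := by rw [Finset.mul_sum]
    _ ≤ B * ‖U‖ ^ 2 := by
        have := sum_preact_sq_le U x
        rw [hx, one_pow, mul_one] at this
        gcongr

/-- A prediction within distance `1/√2` of a one-hot label has the correct strict maximum. -/
theorem one_le_of_argmaxSet_ne {y f : EuclideanSpace ℝ (Fin K)} (hy : IsOneHot y)
    (h : argmaxSet y ≠ argmaxSet f) : 1 ≤ √2 * ‖f - y‖ := by
  obtain ⟨l, rfl⟩ := hy
  by_contra! hlt
  refine h ?_
  have hsq : ‖f - EuclideanSpace.single l 1‖ ^ 2 < 1 / 2 := by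
    have h2 := pow_lt_pow_left₀ hlt (by positivity) two_ne_zero
    rw [mul_pow, Real.sq_sqrt (by norm_num)] at h2
    linarith
  rw [EuclideanSpace.real_norm_sq_eq] at hsq
  have hj : ∀ j, j ≠ l → f j < f l := by
    intro j hjl
    have h2 := Finset.sum_le_sum_of_subset_of_nonneg (f := fun i =>
      ((f - EuclideanSpace.single l (1:ℝ)) i) ^ 2) (Finset.subset_univ {j, l})
      fun _ _ _ => sq_nonneg _
    rw [Finset.sum_pair hjl] at h2
    simp [hjl] at h2
    simp at hsq
    nlinarith [sq_nonneg (f j + f l - 1), sq_nonneg (f j - f l + 1)]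
  ext i
  simp only [argmaxSet, Set.mem_ofPred_eq]
  constructor
  · intro hi j
    have hil : i = l := by
      by_contra hne
      have := hi l
      simp [hne] at this
      linarith
    subst hil
    rcases eq_or_ne j i with rfl | hne
    · exact le_rfl
    · exact (hj j hne).le
  · intro hi j
    have hil : i = l := by
      by_contra hne
      exact absurd (hi l) (not_le.2 (hj i hne))
    subst hil
    rcases eq_or_ne j i with rfl | hne
    · exact le_rfl
    · simp [hne]

/-- The classification error is bounded by the population surrogate loss of the linearised
network, up to the linearisation error `ω`. -/
theorem classError_le (D : Measure (Example d K)) [IsProbabilityMeasure D] {φ : ℝ → ℝ}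
    (hφ : Continuous φ) (V : Matrix (Fin K) (Fin k) ℝ) (W₀ U : Weights k d) {ω : ℝ} (hω0 : 0 ≤ ω)
    (hx : ∀ᵐ z ∂D, ‖z.1‖ = 1) (hy : ∀ᵐ z ∂D, IsOneHot z.2)
    (hω : ∀ x : EuclideanSpace ℝ (Fin d), ‖x‖ = 1 → ‖net V φ (W₀ + U) x
        - WithLp.toLp 2 fun l => net V φ W₀ x l + ⟪outputGrad V φ W₀ l x, U⟫‖ ≤ ω) :
    classError D V φ (W₀ + U) ≤ (∫ z, surrogate V φ W₀ U z ∂D) + √2 * ω := by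
  have hint : Integrable (surrogate V φ W₀ U) D :=
    integrable_of_abs_le (measurable_surrogate hφ V W₀ U) (M := 1) fun z => by
      rw [abs_of_nonneg (surrogate_nonneg V φ W₀ U z)]
      exact surrogate_le_one V φ W₀ U z
  have hmk := mul_meas_ge_le_integral_of_nonneg (μ := D)
    (f := fun z => surrogate V φ W₀ U z + √2 * ω)
    (Filter.Eventually.of_forall fun z => by
      have := surrogate_nonneg V φ W₀ U z
      simp only [Pi.zero_apply]; positivity)
    (hint.add (integrable_const _)) 1
  rw [integral_add hint (integrable_const _)] at hmk
  simp only [integral_const, probReal_univ, one_smul, one_mul] at hmk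
  refine le_trans ?_ hmk
  refine ENNReal.toReal_mono (measure_ne_top _ _) (measure_mono_ae ?_)
  filter_upwards [hx, hy] with z hzx hzy hz
  have h1 := one_le_of_argmaxSet_ne hzy hz
  have h2 := hω z.1 hzx
  change 1 ≤ surrogate V φ W₀ U z + √2 * ω
  unfold surrogate
  rcases min_choice 1 (√2 * ‖(WithLp.toLp 2 fun l => net V φ W₀ z.1 l
    + ⟪outputGrad V φ W₀ l z.1, U⟫) - z.2‖) with h | h <;> rw [h]
  · have : 0 ≤ √2 * ω := by positivity
    linarith
  · rw [← mul_add]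
    refine h1.trans ?_
    gcongr
    refine le_trans (le_of_eq ?_) ((norm_add_le _ _).trans (add_le_add_right h2 _))
    congr 1
    abel

/-- The empirical surrogate loss of the linearised network is bounded by the training residual of
the network. -/
theorem sum_surrogate_le {φ : ℝ → ℝ} (V : Matrix (Fin K) (Fin k) ℝ) (W₀ U : Weights k d) {ω : ℝ}
    {S : Fin n → Example d K} (hS : ∀ i, ‖(S i).1‖ = 1)
    (hω : ∀ x : EuclideanSpace ℝ (Fin d), ‖x‖ = 1 → ‖net V φ (W₀ + U) x
        - WithLp.toLp 2 fun l => net V φ W₀ x l + ⟪outputGrad V φ W₀ l x, U⟫‖ ≤ ω) :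
    ∑ i, surrogate V φ W₀ U (S i) ≤ √2 * (√n * ‖residual V φ S (W₀ + U)‖ + n * ω) := by
  have h1 : ∀ i, surrogate V φ W₀ U (S i)
      ≤ √2 * (‖net V φ (W₀ + U) (S i).1 - (S i).2‖ + ω) := by
    intro i
    refine (min_le_right _ _).trans ?_
    gcongr
    have h2 := hω (S i).1 (hS i)
    rw [norm_sub_rev] at h2
    refine le_trans (le_of_eq ?_) ((norm_add_le _ _).trans (add_le_add_right h2 _))
    congr 1
    abel
  have hnorm : ‖residual V φ S (W₀ + U)‖ ^ 2
      = ∑ i, ‖net V φ (W₀ + U) (S i).1 - (S i).2‖ ^ 2 := by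
    simp only [EuclideanSpace.real_norm_sq_eq]
    rw [Fintype.sum_prod_type]
    rfl
  have hcs := Real.sum_mul_le_sqrt_mul_sqrt Finset.univ (fun _ : Fin n => (1:ℝ))
    fun i => ‖net V φ (W₀ + U) (S i).1 - (S i).2‖
  simp only [one_mul, one_pow, Finset.sum_const, Finset.card_univ, Fintype.card_fin,
    nsmul_eq_mul, mul_one] at hcs
  rw [← hnorm, Real.sqrt_sq (norm_nonneg _)] at hcs
  refine (Finset.sum_le_sum fun i _ => h1 i).trans ?_
  rw [← Finset.mul_sum, Finset.sum_add_distrib]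
  simp only [Finset.sum_const, Finset.card_univ, Fintype.card_fin, nsmul_eq_mul]
  gcongr

end Surrogate

/-! ### Width and time scales -/

/-- The scales of the problem: `p = √‖X‖`, `q = n^{1/4}`, `g = √Γ`, `w = √k`, `μ = ν B`. The width
makes the accumulated perturbation `x` and the linearisation error of order `ζ`. The sharper bound
on `x g` is what keeps the distance between the true and the linearised weights, of order
`g x C q² / α`, small relative to `ζ`; it uses `α ≤ β`, i.e. `a q ≤ p`. -/
theorem width_scales {μ a p q g C ζ w : ℝ} (hμ : 0 < μ) (ha : 0 < a) (hp : 0 < p) (hq : 0 < q)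
    (hg : 1 ≤ g) (hC : 0 < C) (hζ : 0 < ζ) (hw : 0 < w) (hαβ : μ * a * q * p ≤ μ * p ^ 2)
    (hpq : p ≤ q) (hwidth : 100 * C * g ^ 4 ≤ w * (a ^ 4 * μ * ζ)) {α β R x : ℝ}
    (hα : α = μ * a * q * p) (hβ : β = μ * p ^ 2) (hR : R = 2 * g * C * q ^ 2 / α)
    (hx : x = 2 * (g ^ 2 / α ^ 2) * β * (β / w * R)) :
    x * g ≤ ζ * a * p / (25 * q) ∧ x ≤ ζ / 25 ∧ μ * R ^ 2 / w ≤ C * ζ / 25 := by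
  have hg0 : 0 < g := by linarith
  have haq : a * q ≤ p := by
    refine le_of_mul_le_mul_left ?_ (show 0 < μ * p by positivity)
    linarith
  have ha1 : a ≤ 1 := by
    refine le_of_mul_le_mul_right ?_ hq
    linarith
  have hx' : x = 4 * g ^ 3 * C * p / (μ * a ^ 3 * q * w) := by
    rw [hx, hR, hα, hβ]; field_simp; ring
  have h1 : x * g ≤ ζ * a * p / (25 * q) := by
    rw [hx', div_mul_eq_mul_div, div_le_div_iff₀ (by positivity) (by positivity)]
    have := mul_le_mul_of_nonneg_left hwidth (show 0 ≤ p * q by positivity)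
    nlinarith
  have hx0 : 0 ≤ x := by rw [hx']; positivity
  refine ⟨h1, ?_, ?_⟩
  · have h2 : x * 1 ≤ x * g := by gcongr
    have h3 : ζ * a * p / (25 * q) ≤ ζ / 25 := by
      rw [div_le_div_iff₀ (by positivity) (by norm_num)]
      have : a * p ≤ 1 * q := by gcongr
      nlinarith
    linarith
  · have e : μ * R ^ 2 / w = 4 * g ^ 2 * C ^ 2 * q ^ 2 / (μ * a ^ 2 * p ^ 2 * w) := by
      rw [hR, hα]; field_simp; norm_num
    rw [e, div_le_div_iff₀ (by positivity) (by norm_num)]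
    have h2 : (a * q) ^ 2 ≤ p ^ 2 := by gcongr
    have hg2 : (1:ℝ) ≤ g ^ 2 := one_le_pow₀ hg
    have h3 : 100 * C * g ^ 2 ≤ w * (a ^ 4 * μ * ζ) := by
      refine le_trans ?_ hwidth
      have : g ^ 2 ≤ g ^ 4 := pow_le_pow_right₀ hg (by norm_num)
      gcongr
    calc 4 * g ^ 2 * C ^ 2 * q ^ 2 * 25 = (100 * C * g ^ 2) * (C * q ^ 2) := by ring
      _ ≤ (w * (a ^ 4 * μ * ζ)) * (C * q ^ 2) := by gcongr
      _ = C * ζ * (μ * a ^ 2 * w) * (a * q) ^ 2 := by ring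
      _ ≤ C * ζ * (μ * a ^ 2 * w) * p ^ 2 := by gcongr
      _ = _ := by ring

/-! ### Training and generalisation -/

section Training

variable {n d k K : ℕ}

set_option maxHeartbeats 400000 in
/-- The deterministic part of the theorem: on a sample with unit inputs, gradient descent at time
`Γ / α²` has a small residual and a small displacement, and the latter also controls the
linearisation error of the network. -/
theorem training_bounds {S : Fin n → Example d K} {φ : ℝ → ℝ} {V : Matrix (Fin K) (Fin k) ℝ}
    {W₀ : Weights k d} {B ν ζ Γ a C : ℝ} (hn : 0 < n) (hK : 0 < K) (hk : 0 < k)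
    (hS : ∀ i, ‖(S i).1‖ = 1) (hB : 0 < B) (hφ : Differentiable ℝ φ)
    (hφ2 : Differentiable ℝ (deriv φ)) (hφ' : ∀ t, |deriv φ t| ≤ B)
    (hφ'' : ∀ t, |deriv (deriv φ) t| ≤ B) (hν : 0 < ν)
    (hV : ∀ l s, |V l s| ≤ ν / √((k : ℝ) * K)) (hζ : 0 < ζ) (hζ2 : ζ ≤ 1 / 2) (hΓ : 1 ≤ Γ)
    (ha : 0 < a) (hC : 0 < C)
    (hwidth : 100 * C * Γ ^ 2 ≤ √k * (a ^ 4 * (ν * B) * ζ))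
    (hr : ‖residual V φ S W₀‖ / √n ≤ C)
    (hα : cutoff ν B a S ≤ ⨆ s, singularValue (jacobian V φ S W₀) s)
    {η : ℝ} {T : ℕ} (hη : 0 < η) (hηβ : η ≤ 1 / (ν * B * ‖dataMatrix S‖) ^ 2)
    (hT : (T : ℝ) = Γ / (η * cutoff ν B a S ^ 2)) :
    ‖residual V φ S (gradDescent V φ S η W₀ T)‖ / √n
      ≤ ‖(nuisanceSpace (jacobian V φ S W₀) (cutoff ν B a S)).starProjection
          (residual V φ S W₀)‖ / √n + C * (Real.exp (-Γ) + 2 * ζ / 25) ∧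
    ν * B * ‖gradDescent V φ S η W₀ T - W₀‖ / √n
      ≤ ν * B / √n * (‖WithLp.toLp 2 (pseudoInverse (truncated (jacobian V φ S W₀)
            (cutoff ν B a S)) *ᵥ (residual V φ S W₀).ofLp)‖
          + Γ / cutoff ν B a S * ‖(nuisanceSpace (jacobian V φ S W₀)
            (cutoff ν B a S)).starProjection (residual V φ S W₀)‖) + 3 * C * ζ / 25 ∧
    ν / √k * (B * ‖gradDescent V φ S η W₀ T - W₀‖ ^ 2) ≤ C * ζ / 25 := by
  set α := cutoff ν B a S with hαdef
  set J := jacobian V φ S W₀ with hJ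
  set r₀ := residual V φ S W₀ with hr₀
  have hn' : (0:ℝ) < n := by exact_mod_cast hn
  have hn1 : (1:ℝ) ≤ n := by exact_mod_cast hn
  have hk' : (0:ℝ) < k := by exact_mod_cast hk
  -- The scales of `width_scales`.
  set μ := ν * B with hμ
  set p := √‖dataMatrix S‖ with hp
  set q := (n:ℝ) ^ (1 / 4 : ℝ) with hq
  set g := √Γ with hg
  set w := √(k:ℝ) with hw
  have hμ0 : 0 < μ := by positivity
  -- For `X = 0` the step-size condition would read `η ≤ 1 / 0 = 0`.
  have hX0 : 0 < ‖dataMatrix S‖ := by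
    rcases (norm_nonneg (dataMatrix S)).eq_or_lt with h | h
    · rw [← h] at hηβ; simp at hηβ; linarith
    · exact h
  have hp0 : 0 < p := Real.sqrt_pos.2 hX0
  have hp2 : p ^ 2 = ‖dataMatrix S‖ := Real.sq_sqrt hX0.le
  have hq0 : 0 < q := Real.rpow_pos_of_pos hn' _
  have hq1 : 1 ≤ q := Real.one_le_rpow hn1 (by norm_num)
  have hq2 : q ^ 2 = √n := by
    rw [hq, ← Real.rpow_natCast, ← Real.rpow_mul hn'.le, Real.sqrt_eq_rpow]; norm_num
  have hg1 : 1 ≤ g := Real.one_le_sqrt.2 hΓ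
  have hg2 : g ^ 2 = Γ := Real.sq_sqrt (by linarith)
  have hg0 : 0 < g := by linarith
  have hw0 : 0 < w := Real.sqrt_pos.2 hk'
  have hαe : α = μ * a * q * p := rfl
  have hα0 : 0 < α := by rw [hαe]; positivity
  set β := μ * p ^ 2 with hβ
  have hβ0 : 0 < β := by positivity
  have hpq : p ≤ q := by
    refine abs_le_of_sq_le_sq' ?_ hq0.le |>.2
    rw [hp2, hq2]
    exact norm_dataMatrix_le hS
  -- Gradient descent as a least-squares iteration.
  set f := predictions V φ S with hf
  have hfd : Differentiable ℝ f := fun W => (hasFDerivAt_predictions hφ V S W).differentiableAt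
  set A := fderiv ℝ f W₀ with hA
  have hAJ : ∀ U, (A U).ofLp = J *ᵥ U.ofLp := fderiv_predictions_ofLp V φ S W₀
  have hfβ : ∀ W, ‖fderiv ℝ f W‖ ≤ β := fun W => by
    rw [hβ, hp2]
    exact norm_fderiv_predictions_le hφ hB.le hν.le hk hφ' hV S W
  have hfL : ∀ W, ‖fderiv ℝ f W - A‖ ≤ β / w * ‖W - W₀‖ := fun W => by
    rw [hβ, hp2]
    exact norm_fderiv_predictions_sub_le hφ hφ2 hB.le hν.le hk hφ'' hV hS W W₀
  have hαβ : α ≤ β := by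
    have : Nonempty (Fin n × Fin K) := ⟨(⟨0, hn⟩, ⟨0, hK⟩)⟩
    exact hα.trans (ciSup_le fun s => (singularValue_le hAJ s).trans (hfβ W₀))
  set R := 2 * g * C * q ^ 2 / α with hR
  set θ := Γ / α ^ 2 with hθ
  set x := 2 * θ * β * (β / w * R) with hx
  have hθg : θ = g ^ 2 / α ^ 2 := by rw [hθ, hg2]
  have hsqrtθ : √θ = g / α := by
    rw [hθg, ← div_pow, Real.sqrt_sq (by positivity)]
  have hR0 : 0 < R := by positivity
  have hθ0 : 0 < θ := by rw [hθg]; positivity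
  have hx0 : 0 ≤ x := by positivity
  obtain ⟨hx1, hx2, hω⟩ := width_scales (α := α) (β := β) (R := R) (x := x) hμ0 ha hp0 hq0 hg1 hC hζ
    hw0 (by rw [← hαe]; exact hαβ) hpq (by
      rw [show g ^ 4 = (g ^ 2) ^ 2 by ring, hg2]; exact hwidth) hαe hβ hR (by rw [hx, hθg])
  have hexp : Real.exp x ≤ 1 + 2 * x := by
    have := Real.abs_exp_sub_one_sub_id_le (x := x) (by rw [abs_of_nonneg hx0]; linarith)
    have hle := (abs_le.1 this).2
    have hsq : x ^ 2 ≤ x * 1 := by rw [sq]; gcongr; linarith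
    linarith only [hle, hsq]
  have hexp' : Real.exp x ≤ 5 / 4 := by linarith
  have hdrift : θ * (β / w * R) = x / (2 * β) := by
    rw [hx]; field_simp
  have hdrift' : θ * (β / w * R) ≤ g * x / (2 * α) := by
    rw [hdrift, div_le_div_iff₀ (by positivity) (by positivity)]
    have h1 : 2 * x * (α * 1) ≤ 2 * x * (β * g) := by gcongr
    linarith only [h1]
  have hr' : ‖r₀‖ ≤ C * q ^ 2 := by
    rw [hq2]
    rwa [div_le_iff₀ (by positivity)] at hr
  have hηβ' : η * β ^ 2 ≤ 1 := by
    rw [hβ, hp2]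
    rwa [le_div_iff₀ (by positivity)] at hηβ
  have hηT : η * T = θ := by rw [hT, hθ]; field_simp
  have hball : Real.exp x * ‖f W₀ - labels S‖ * (√θ + θ * (β / w * R)) ≤ R := by
    change Real.exp x * ‖r₀‖ * _ ≤ R
    have h1 : √θ + θ * (β / w * R) ≤ 5 / 4 * (g / α) := by
      rw [hsqrtθ]
      have : g * x / (2 * α) ≤ 1 / 4 * (g / α) := by
        rw [show g * x / (2 * α) = x / 2 * (g / α) by ring]
        exact mul_le_mul_of_nonneg_right (by linarith) (by positivity)
      linarith
    calc Real.exp x * ‖r₀‖ * (√θ + θ * (β / w * R))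
        ≤ 5 / 4 * (C * q ^ 2) * (5 / 4 * (g / α)) := by gcongr
      _ ≤ R := by
        rw [hR, show 5 / 4 * (C * q ^ 2) * (5 / 4 * (g / α)) = 25 / 16 * (g * C * q ^ 2 / α) by ring,
          show 2 * g * C * q ^ 2 / α = 2 * (g * C * q ^ 2 / α) by ring]
        gcongr
        norm_num
  obtain ⟨hin, hres, hdisp⟩ := gradientDescent_near_linear hfd (labels S) hβ0.le hfβ
    (show 0 ≤ β / w by positivity) hR0.le hη.le hηβ' (gradDescent V φ S η W₀) hfL
    (gradDescent_succ hφ V S η W₀) T hηT hx hball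
  change ‖gradDescent V φ S η W₀ T - W₀‖ ≤ R at hin
  change ‖residual V φ S (gradDescent V φ S η W₀ T) - linearIter A η r₀ T‖
    ≤ (Real.exp x - 1) * ‖r₀‖ at hres
  change ‖gradDescent V φ S η W₀ T - W₀
    + η • ∑ s ∈ Finset.range T, ContinuousLinearMap.adjoint A (linearIter A η r₀ s)‖
      ≤ (√θ * (Real.exp x - 1) + θ * (β / w * R) * Real.exp x) * ‖r₀‖ at hdisp
  have hlin := norm_linearIter_le hAJ hη.le (hfβ W₀) hηβ' hα0 hηT r₀
  have hlinW := norm_sum_adjoint_linearIter_le hAJ hη.le (hfβ W₀) hηβ' hα0 (by linarith) hηT r₀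
  have hsn : 0 < √(n:ℝ) := by positivity
  refine ⟨?_, ?_, ?_⟩
  · rw [div_le_iff₀ hsn, add_mul, div_mul_cancel₀ _ hsn.ne', ← hq2]
    have h1 : ‖residual V φ S (gradDescent V φ S η W₀ T)‖
        ≤ ‖residual V φ S (gradDescent V φ S η W₀ T) - linearIter A η r₀ T‖
          + ‖linearIter A η r₀ T‖ := norm_le_norm_sub_add _ _
    have h2 : (Real.exp x - 1) * ‖r₀‖ ≤ 2 * ζ / 25 * (C * q ^ 2) := by
      have : 0 ≤ Real.exp x - 1 := by linarith [Real.add_one_le_exp x]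
      gcongr
      linarith
    have h3 : Real.exp (-Γ) * ‖r₀‖ ≤ Real.exp (-Γ) * (C * q ^ 2) := by gcongr
    linarith
  · set Wlin := η • ∑ s ∈ Finset.range T, ContinuousLinearMap.adjoint A (linearIter A η r₀ s)
    have h1 : ‖gradDescent V φ S η W₀ T - W₀‖
        ≤ ‖gradDescent V φ S η W₀ T - W₀ + Wlin‖ + ‖Wlin‖ := by
      have := norm_sub_le (gradDescent V φ S η W₀ T - W₀ + Wlin) Wlin
      rwa [add_sub_cancel_right] at this
    have h2 : (√θ * (Real.exp x - 1) + θ * (β / w * R) * Real.exp x) * ‖r₀‖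
        ≤ 3 * (g * x / α) * (C * q ^ 2) := by
      have h3 : √θ * (Real.exp x - 1) ≤ 2 * (g * x / α) := by
        rw [hsqrtθ, show 2 * (g * x / α) = g / α * (2 * x) by ring]
        gcongr
        linarith
      have h4 : θ * (β / w * R) * Real.exp x ≤ g * x / (2 * α) * (5 / 4) := by gcongr
      have h5 : g * x / (2 * α) * (5 / 4) ≤ g * x / α := by
        rw [show g * x / (2 * α) * (5 / 4) = 5 / 8 * (g * x / α) by ring]
        have : 0 ≤ g * x / α := by positivity
        linarith
      gcongr
      linarith
    have h6 : μ * (3 * (g * x / α) * (C * q ^ 2)) / √n ≤ 3 * C * ζ / 25 := by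
      have e : μ * (3 * (g * x / α) * (C * q ^ 2)) / √n = 3 * C * (x * g) / (a * q * p) := by
        rw [← hq2, hαe]; field_simp
      rw [e, div_le_iff₀ (by positivity)]
      calc 3 * C * (x * g) ≤ 3 * C * (ζ * a * p / (25 * q)) := by gcongr
        _ = 3 * C * ζ / 25 * (a * (1 / q) * p) := by field_simp
        _ ≤ 3 * C * ζ / 25 * (a * q * p) := by
          gcongr
          exact (div_le_one hq0).2 hq1 |>.trans hq1
    have h7 := mul_le_mul_of_nonneg_left (h1.trans (add_le_add (hdisp.trans h2) hlinW)) hμ0.le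
    have h8 := div_le_div_of_nonneg_right h7 hsn.le
    refine h8.trans ?_
    rw [mul_add, add_div, add_comm, mul_div_right_comm μ]
    gcongr
  · refine le_trans ?_ hω
    rw [show μ * R ^ 2 / w = ν / w * (B * R ^ 2) by rw [hμ]; ring]
    gcongr

end Training

end NNGen

end

theorem mainTheorem2 :
    ∃ c : ℝ, 0 < c ∧
      ∀ (n d k K : ℕ) (D : Measure (NNGen.Example d K)) [IsProbabilityMeasure D]
        (φ : ℝ → ℝ) (V : Matrix (Fin K) (Fin k) ℝ) (W₀ : NNGen.Weights k d)
        (B ν ζ Γ a Cr δ : ℝ),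
        0 < n →
        (∀ᵐ z ∂D, ‖z.1‖ = 1) →
        (∀ᵐ z ∂D, NNGen.IsOneHot z.2) →
        0 < B → Differentiable ℝ φ → Differentiable ℝ (deriv φ) →
        (∀ t, |deriv φ t| ≤ B) → (∀ t, |deriv (deriv φ) t| ≤ B) →
        0 < ν → (∀ l s, |V l s| ≤ ν / √((k : ℝ) * K)) →
        0 < ζ → ζ ≤ 1 / 2 → 1 ≤ Γ → 0 < a → 0 < Cr → 0 < δ → δ < 1 →
        c * (Cr ^ 2 * Γ ^ 4 / (a ^ 8 * ν ^ 2 * B ^ 2 * ζ ^ 2)) ≤ (k : ℝ) →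
        ∃ E : Set (Fin n → NNGen.Example d K), MeasurableSet E ∧
          ENNReal.ofReal (1 - δ) ≤ Measure.pi (fun _ : Fin n => D) E ∧
          ∀ S ∈ E,
            let α := NNGen.cutoff ν B a S
            let J := NNGen.jacobian V φ S W₀
            let r₀ := NNGen.residual V φ S W₀
            let N := NNGen.nuisanceSpace J α
            let β := ν * B * ‖NNGen.dataMatrix S‖
            ‖r₀‖ / √(n : ℝ) ≤ Cr →
            α ≤ ⨆ s, NNGen.singularValue J s →
            ∀ (η : ℝ) (T : ℕ), 0 < η → η ≤ 1 / β ^ 2 → (T : ℝ) = Γ / (η * α ^ 2) →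
              NNGen.classError D V φ (NNGen.gradDescent V φ S η W₀ T) ≤
                2 * ‖N.starProjection r₀‖ / √(n : ℝ)
                + 12 * ν * B / √(n : ℝ)
                  * (‖WithLp.toLp 2 (NNGen.pseudoInverse (NNGen.truncated J α) *ᵥ r₀.ofLp)‖
                    + Γ / α * ‖N.starProjection r₀‖)
                + 5 * √(Real.log (2 / δ) / n)
                + 2 * Cr * (Real.exp (-Γ) + ζ) := by
  -- The square of the constant in `width_scales`, because the width enters there through `√k`.
  refine ⟨100 ^ 2, by norm_num, ?_⟩
  intro n d k K D _ φ V W₀ B ν ζ Γ a C δ hn hx hy hB hφ hφ2 hφ' hφ'' hν hV hζ hζ2 hΓ ha hC hδ hδ1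
    hkc
  have hn' : (0:ℝ) < n := by exact_mod_cast hn
  have hk' : (0:ℝ) < k := lt_of_lt_of_le (by positivity) hkc
  have hk : 0 < k := by exact_mod_cast hk'
  have hwidth : 100 * C * Γ ^ 2 ≤ √k * (a ^ 4 * (ν * B) * ζ) := by
    rw [← div_le_iff₀ (by positivity)]
    refine Real.le_sqrt_of_sq_le (le_trans (le_of_eq ?_) hkc)
    field_simp
  have hK : 0 < K := by
    obtain ⟨z, l, -⟩ := hy.exists
    exact l.pos
  set P : Measure (Fin n → NNGen.Example d K) := Measure.pi fun _ => D
  -- The bad event: an input off the sphere, or a large deviation of the surrogate loss. The good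
  -- event is the complement of its measurable hull, so that `bad₂`, an uncountable union, need not
  -- be shown to be measurable.
  set bad₁ : Set (Fin n → NNGen.Example d K) := {S | ¬ ∀ i, ‖(S i).1‖ = 1}
  set bad₂ : Set (Fin n → NNGen.Example d K) := {S | ∃ U,
    √n * (6 * (ν * B * ‖U‖) + 5 * √(Real.log (2 / δ)))
      < ∑ i, ((∫ z, NNGen.surrogate V φ W₀ U z ∂D) - NNGen.surrogate V φ W₀ U (S i))}
  have h1 : P bad₁ = 0 := by
    change ∀ᵐ S ∂P, ∀ i, ‖(S i).1‖ = 1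
    rw [ae_all_iff]
    exact fun i => (Measure.tendsto_eval_ae_ae (μ := fun _ => D) (i := i)).eventually
      (p := fun z => ‖z.1‖ = 1) hx
  have h2 : P bad₂ ≤ ENNReal.ofReal δ := by
    have h24 : (2 * √3 * √2) ^ 2 = 24 := by
      rw [mul_pow, mul_pow, Real.sq_sqrt (by norm_num), Real.sq_sqrt (by norm_num)]; norm_num
    refine NNGen.measure_exists_deviation_gt_norm_le D
      (fun l z => NNGen.outputGrad V φ W₀ l z.1) (NNGen.measurable_outputGrad V W₀)
      (by positivity) (fun z => NNGen.sum_norm_outputGrad_sq_le hν.le hφ' hV W₀ z.1)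
      (NNGen.surrogate V φ W₀) (NNGen.measurable_surrogate hφ.continuous V W₀)
      (NNGen.surrogate_nonneg V φ W₀) (NNGen.surrogate_le_one V φ W₀) (C := 2 * √3 * √2)
      (by positivity) (by nlinarith [show 0 ≤ 2 * √3 * √2 by positivity]) (fun U U' z => ?_) hn hδ hδ1
    rw [mul_assoc (2 * √3)]
    exact mul_le_mul_of_nonneg_left (NNGen.abs_surrogate_sub_le V φ W₀ U U' z) (by positivity)
  have hbad : P (bad₁ ∪ bad₂) ≤ ENNReal.ofReal δ :=
    (measure_union_le _ _).trans (by rw [h1, zero_add]; exact h2)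
  refine ⟨(toMeasurable P (bad₁ ∪ bad₂))ᶜ, (measurableSet_toMeasurable _ _).compl, ?_, ?_⟩
  · rw [prob_compl_eq_one_sub (measurableSet_toMeasurable _ _), measure_toMeasurable,
      ENNReal.ofReal_sub _ hδ.le, ENNReal.ofReal_one]
    exact tsub_le_tsub_left hbad 1
  intro S hSE α J r₀ N β hr hα η T hη hηβ hT
  have hSbad : S ∉ bad₁ ∪ bad₂ := fun h => hSE (subset_toMeasurable _ _ h)
  have hS : ∀ i, ‖(S i).1‖ = 1 := by
    by_contra h
    exact hSbad (Or.inl h)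
  obtain ⟨hres, hdisp, hω⟩ := NNGen.training_bounds hn hK hk hS hB hφ hφ2 hφ' hφ'' hν hV hζ hζ2 hΓ
    ha hC hwidth hr hα hη hηβ hT
  set W := NNGen.gradDescent V φ S η W₀ T
  set U := W - W₀ with hU
  have hWU : W₀ + U = W := by rw [hU]; abel
  have hdev : ∑ i, ((∫ z, NNGen.surrogate V φ W₀ U z ∂D) - NNGen.surrogate V φ W₀ U (S i))
      ≤ √n * (6 * (ν * B * ‖U‖) + 5 * √(Real.log (2 / δ))) := by
    by_contra! h
    exact hSbad (Or.inr ⟨U, h⟩)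
  have hrem : ∀ x : EuclideanSpace ℝ (Fin d), ‖x‖ = 1 → ‖NNGen.net V φ (W₀ + U) x
      - WithLp.toLp 2 fun l => NNGen.net V φ W₀ x l + inner ℝ (NNGen.outputGrad V φ W₀ l x) U‖
        ≤ C * ζ / 25 := fun x hx' =>
    (NNGen.norm_net_sub_linear_le hφ hφ2 hB.le hν.le hk hφ'' hV W₀ U hx').trans hω
  have herr := NNGen.classError_le D hφ.continuous V W₀ U (by positivity) hx hy hrem
  have hemp := NNGen.sum_surrogate_le V W₀ U hS hrem
  rw [hWU] at herr hemp
  rw [Finset.sum_sub_distrib, Finset.sum_const, Finset.card_univ, Fintype.card_fin,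
    nsmul_eq_mul] at hdev
  have hs2 : √2 ≤ 3 / 2 := Real.sqrt_le_iff.2 ⟨by norm_num, by norm_num⟩
  have hsn : 0 < √(n:ℝ) := by positivity
  have hsn2 : √(n:ℝ) * √n = n := Real.mul_self_sqrt hn'.le
  have hpop : ∫ z, NNGen.surrogate V φ W₀ U z ∂D
      ≤ √2 * (‖NNGen.residual V φ S W‖ / √n + C * ζ / 25)
        + (6 * (ν * B * ‖U‖ / √n) + 5 * (√(Real.log (2 / δ)) / √n)) := by
    refine le_of_mul_le_mul_left ?_ hn'
    refine (sub_le_iff_le_add.1 hdev).trans ((add_le_add_right hemp _).trans (le_of_eq ?_))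
    generalize √(n:ℝ) = w at hsn hsn2 ⊢
    rw [← hsn2]
    field_simp
    ring
  rw [Real.sqrt_div' _ hn'.le]
  have hC0 : 0 ≤ C * ζ / 25 := by positivity
  have hres0 : 0 ≤ ‖NNGen.residual V φ S W‖ / √n := by positivity
  have e1 : √2 * (‖NNGen.residual V φ S W‖ / √n + C * ζ / 25)
      ≤ 3 / 2 * (‖NNGen.residual V φ S W‖ / √n + C * ζ / 25) := by gcongr
  have e2 : √2 * (C * ζ / 25) ≤ 3 / 2 * (C * ζ / 25) := by gcongr
  set πN := ‖N.starProjection r₀‖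
  set Q := ‖WithLp.toLp 2 (NNGen.pseudoInverse (NNGen.truncated J α) *ᵥ r₀.ofLp)‖
  have hπN : 0 ≤ πN / √n := by positivity
  have hα0 : 0 ≤ α := by unfold α NNGen.cutoff; positivity
  have hQ : 0 ≤ ν * B / √n * (Q + Γ / α * πN) := by positivity
  have hexp := Real.exp_pos (-Γ)
  rw [show 2 * πN / √n = 2 * (πN / √n) by ring, show 12 * ν * B / √n * (Q + Γ / α * πN)
    = 12 * (ν * B / √n * (Q + Γ / α * πN)) by ring]
  change ‖NNGen.residual V φ S W‖ / √n ≤ πN / √n + C * (Real.exp (-Γ) + 2 * ζ / 25) at hres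
  change ν * B * ‖U‖ / √n ≤ ν * B / √n * (Q + Γ / α * πN) + 3 * C * ζ / 25 at hdisp
  have hCe : 0 ≤ C * Real.exp (-Γ) := by positivity
  have hCζ : 0 ≤ C * ζ := by positivity
  linarith
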